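/- Let $d,m\ge 0$ and $S\ge 1$ be integers, let $(x_s,y_s)\in\mathbb R^d\times\mathbb R^m$, $s=1,\dots,S$, and fix an arbitrary norm, always written $\|\cdot\|$, on each of $\mathbb R^d$, $\mathbb R^m$, $\mathbb R^{d\times d}$, $\mathbb R^{m\times d}$. Let $\alpha_1,\alpha_2,\alpha_3,\alpha_4>0$ and $\tau_1,\tau_2>0$, let $h:\mathbb R^m\to\mathbb R^m$ be continuous, and let $\sigma:\mathbb R^d\to\mathbb R^d$ be Lipschitz continuous with $\sigma(0)=0$. For an integer $n\ge 1$ let $\Theta^{(n)}$ be the set of $\theta^{(n)}=(K^{(n)},b^{(n)},W,c)$ with $K^{(n)}=(K^{(n)}_i)_{i=0}^{n-1}\subset\mathbb R^{d\times d}$, $b^{(n)}=(b^{(n)}_i)_{i=0}^{n-1}\subset\mathbb R^d$, $W\in\mathbb R^{m\times d}$, $c\in\mathbb R^m$. Given $x\in\mathbb R^d$ let $X^{(n)}_0=x$ and $X^{(n)}_{i+1}=X^{(n)}_i+\frac1n\sigma(K^{(n)}_iX^{(n)}_i+b^{(n)}_i)$ for $0\le i\le n-1$, and write $X^{(n)}_n[x;K^{(n)},b^{(n)}]$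 for the final state. Define $$\mathcal E_n(\theta^{(n)})=\sum_{s=1}^S\big\|h(WX^{(n)}_n[x_s;K^{(n)},b^{(n)}]+c)-y_s\big\|^2+\alpha_1R^{(1)}_n(K^{(n)})+\alpha_2R^{(2)}_n(b^{(n)})+\alpha_3\|W\|^2+\alpha_4\|c\|^2,$$ where $R^{(1)}_n(K^{(n)})=n\sum_{i=1}^{n-1}\|K^{(n)}_i-K^{(n)}_{i-1}\|^2+\tau_1\|K^{(n)}_0\|^2$ and $R^{(2)}_n(b^{(n)})=n\sum_{i=1}^{n-1}\|b^{(n)}_i-b^{(n)}_{i-1}\|^2+\tau_2\|b^{(n)}_0\|^2$. Let $\Theta=H^1([0,1];\mathbb R^{d\times d})\times H^1([0,1];\mathbb R^d)\times\mathbb R^{m\times d}\times\mathbb R^m$. For $\theta=(K,b,W,c)\in\Theta$ let $X(\cdot;x,K,b)$ be the solution of $\dot X(t)=\sigma(K(t)X(t)+b(t))$ on $[0,1]$ with $X(0)=x$, and define $$\mathcal E_\infty(\theta)=\sum_{s=1}^S\big\|h(WX(1;x_s,K,b)+c)-y_s\big\|^2+\alpha_1\big(\|\dot K\|_{L^2}^2+\tau_1\|K(0)\|^2\big)+\alpha_2\big(\|\dot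 b\|_{L^2}^2+\tau_2\|b(0)\|^2\big)+\alpha_3\|W\|^2+\alpha_4\|c\|^2,$$ where $\dot K,\dot b$ are weak derivatives and pointwise values are those of the continuous representatives. For $\theta^{(n)}=(K^{(n)},b^{(n)},W^{(n)},c^{(n)})\in\Theta^{(n)}$ and $\theta=(K,b,W,c)\in\Theta$ let $$d(\theta^{(n)},\theta)=\|\tilde K^{(n)}-K\|_{L^2}+\|\tilde b^{(n)}-b\|_{L^2}+\|W^{(n)}-W\|+\|c^{(n)}-c\|,$$ where $\tilde K^{(n)}(t)=K^{(n)}_i$ and $\tilde b^{(n)}(t)=b^{(n)}_i$ for $t\in[\frac in,\frac{i+1}n)$, $i=0,\dots,n-1$. Write $\theta^{(n)}\to\theta$ if $d(\theta^{(n)},\theta)\to0$. Then: 1. For every $n\ge1$ there exists a minimiser of $\mathcal E_n$ in $\Theta^{(n)}$. 2. Every sequence $\theta^{(n)}\in\Theta^{(n)}$, $n\ge1$, with $\sup_{n}\mathcal E_n(\theta^{(n)})<\infty$ is relatively compact: each of its subsequences has a further subsequence that converges in the distance $d$ to some $\theta\in\Theta$. 3. $\mathcal E_n$ $\Gamma$-converges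 to $\mathcal E_\infty$: for every $\theta\in\Theta$, (i) $\liminf_{n\to\infty}\mathcal E_n(\theta^{(n)})\ge\mathcal E_\infty(\theta)$ for every sequence $\theta^{(n)}\in\Theta^{(n)}$ with $\theta^{(n)}\to\theta$, and (ii) there is a sequence $\theta^{(n)}\in\Theta^{(n)}$ with $\theta^{(n)}\to\theta$ and $\limsup_{n\to\infty}\mathcal E_n(\theta^{(n)})\le\mathcal E_\infty(\theta)$. -/

import Mathlib

open MeasureTheory Filter Topology Set
open scoped Matrix ContDiff
-- The entrywise norm on matrices is used only as the reference norm for measurability, integrals and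
-- derivatives of matrix-valued functions; the norms of the model are arbitrary, see `VNorm`.
open scoped Matrix.Norms.Elementwise

namespace DeepLayer

/-- An arbitrary norm on a real vector space. -/
structure VNorm (V : Type) [AddCommGroup V] [Module ℝ V] extends Seminorm ℝ V where
  eq_zero' : ∀ v : V, toFun v = 0 → v = 0

instance (V : Type) [AddCommGroup V] [Module ℝ V] : CoeFun (VNorm V) (fun _ => V → ℝ) :=
  ⟨fun N v => N.toSeminorm v⟩

section Sobolev

variable {V : Type} [NormedAddCommGroup V] [NormedSpace ℝ V]

/-- `g` is a weak derivative of `f` on the interval `(0,1)`. -/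
def IsWeakDeriv (f g : ℝ → V) : Prop :=
  ∀ φ : ℝ → ℝ, ContDiff ℝ ∞ φ → HasCompactSupport φ → tsupport φ ⊆ Ioo 0 1 →
    ∫ t in (0 : ℝ)..1, deriv φ t • f t = - ∫ t in (0 : ℝ)..1, φ t • g t

/-- Membership in `L²([0,1]; V)`. Only the values on `[0,1]` matter. -/
def MemL2 (f : ℝ → V) : Prop := MemLp f 2 (volume.restrict (Icc (0 : ℝ) 1))

/-- Membership in `H¹([0,1]; V)`: `f` is in `L²` and has a weak derivative in `L²`. -/
def MemH1 (f : ℝ → V) : Prop := MemL2 f ∧ ∃ g : ℝ → V, MemL2 g ∧ IsWeakDeriv f g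

open Classical in
/-- The weak derivative of an `H¹` function (unique up to null sets). -/
noncomputable def weakDeriv (f : ℝ → V) : ℝ → V :=
  if h : ∃ g : ℝ → V, MemL2 g ∧ IsWeakDeriv f g then h.choose else 0

open Classical in
/-- The continuous representative of an `H¹` function (unique on `[0,1]`), through which pointwise
values such as `K(0)` are defined. -/
noncomputable def contRep (f : ℝ → V) : ℝ → V :=
  if h : ∃ g : ℝ → V, ContinuousOn g (Icc 0 1) ∧ f =ᵐ[volume.restrict (Icc (0 : ℝ) 1)] g
  then h.choose else 0

end Sobolev

section Layers

variable {V : Type} [AddCommGroup V] [Module ℝ V]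

/-- The entry `a_i` of a family `a_0, …, a_{n-1}` (zero for `i ≥ n`, which is never relevant). -/
def layer {n : ℕ} (a : Fin n → V) (i : ℕ) : V := if h : i < n then a ⟨i, h⟩ else 0

/-- Piecewise constant extension: equal to `a_i` on `[i/n, (i+1)/n)`, for `i = 0, …, n-1`. -/
noncomputable def stepExt {n : ℕ} (a : Fin n → V) (t : ℝ) : V := layer a ⌊(n : ℝ) * t⌋₊

/-- `n ∑_{i=1}^{n-1} ‖a_i - a_{i-1}‖² + τ ‖a_0‖²`. -/
noncomputable def discreteReg (N : VNorm V) (τ : ℝ) {n : ℕ} (a : Fin n → V) : ℝ :=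
  n * (∑ i ∈ Finset.Ico 1 n, N (layer a i - layer a (i - 1)) ^ 2) + τ * N (layer a 0) ^ 2

/-- The discrete-to-continuum distance `‖ã - f‖_{L²}`. -/
noncomputable def stepDist (N : VNorm V) {n : ℕ} (a : Fin n → V) (f : ℝ → V) : ℝ :=
  Real.sqrt (∫ t in (0 : ℝ)..1, N (stepExt a t - f t) ^ 2)

end Layers

/-- `‖ḟ‖²_{L²} + τ ‖f(0)‖²` for `f ∈ H¹([0,1]; V)`. -/
noncomputable def continuumReg {V : Type} [NormedAddCommGroup V] [NormedSpace ℝ V]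
    (N : VNorm V) (τ : ℝ) (f : ℝ → V) : ℝ :=
  (∫ t in (0 : ℝ)..1, N (weakDeriv f t) ^ 2) + τ * N (contRep f 0) ^ 2

/-- The parameter space `Θ⁽ⁿ⁾` of the network with `n` layers. -/
structure ThetaN (d m n : ℕ) where
  K : Fin n → Matrix (Fin d) (Fin d) ℝ
  b : Fin n → Fin d → ℝ
  W : Matrix (Fin m) (Fin d) ℝ
  c : Fin m → ℝ

/-- The limiting parameter space
`Θ = H¹([0,1]; ℝ^{d×d}) × H¹([0,1]; ℝ^d) × ℝ^{m×d} × ℝ^m`. Elements of `H¹` are given by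
representatives; all notions below depend on the almost-everywhere classes on `[0,1]` only. -/
structure Theta (d m : ℕ) where
  K : ℝ → Matrix (Fin d) (Fin d) ℝ
  b : ℝ → Fin d → ℝ
  W : Matrix (Fin m) (Fin d) ℝ
  c : Fin m → ℝ
  memH1_K : MemH1 K
  memH1_b : MemH1 b

/-- The data of the learning problem: activation function `σ`, classification function `h`,
training data `(x_s, y_s)`, regularisation weights, and a norm on each of `ℝ^d`,
`ℝ^{d×d}`, `ℝ^{m×d}` and `ℝ^m`. -/
structure Model (d m S : ℕ) where
  σ : (Fin d → ℝ) → (Fin d → ℝ)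
  h : (Fin m → ℝ) → (Fin m → ℝ)
  x : Fin S → Fin d → ℝ
  y : Fin S → Fin m → ℝ
  (α₁ α₂ α₃ α₄ τ₁ τ₂ : ℝ)
  normB : VNorm (Fin d → ℝ)
  normK : VNorm (Matrix (Fin d) (Fin d) ℝ)
  normW : VNorm (Matrix (Fin m) (Fin d) ℝ)
  normC : VNorm (Fin m → ℝ)

/-- The states `X_i` of the residual network:
`X_0 = x₀`, `X_{i+1} = X_i + (1/n) σ(K_i X_i + b_i)`. -/
noncomputable def forward {d n : ℕ} (σ : (Fin d → ℝ) → (Fin d → ℝ))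
    (K : Fin n → Matrix (Fin d) (Fin d) ℝ) (b : Fin n → Fin d → ℝ) (x₀ : Fin d → ℝ) :
    ℕ → Fin d → ℝ
  | 0 => x₀
  | i + 1 => forward σ K b x₀ i +
      (1 / (n : ℝ)) • σ (layer K i *ᵥ forward σ K b x₀ i + layer b i)

/-- `X` solves `Ẋ(t) = σ(K(t) X(t) + b(t))` on `[0,1]` with `X(0) = x₀`. -/
def IsODESolution {d : ℕ} (σ : (Fin d → ℝ) → (Fin d → ℝ)) (K : ℝ → Matrix (Fin d) (Fin d) ℝ)
    (b : ℝ → Fin d → ℝ) (x₀ : Fin d → ℝ) (X : ℝ → Fin d → ℝ) : Prop :=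
  X 0 = x₀ ∧ ∀ t ∈ Icc (0 : ℝ) 1,
    HasDerivWithinAt X (σ (contRep K t *ᵥ X t + contRep b t)) (Icc 0 1) t

open Classical in
/-- The solution `X(·; x₀, K, b)`; it exists and is unique on `[0,1]` for Lipschitz `σ`
and `K`, `b` in `H¹`. -/
noncomputable def odeSolution {d : ℕ} (σ : (Fin d → ℝ) → (Fin d → ℝ))
    (K : ℝ → Matrix (Fin d) (Fin d) ℝ) (b : ℝ → Fin d → ℝ) (x₀ : Fin d → ℝ) : ℝ → Fin d → ℝ :=
  if hX : ∃ X, IsODESolution σ K b x₀ X then hX.choose else 0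

namespace Model

variable {d m S : ℕ} (P : Model d m S)

/-- The finite layer objective `𝓔_n`. -/
noncomputable def En {n : ℕ} (θ : ThetaN d m n) : ℝ :=
  (∑ s, P.normC (P.h (θ.W *ᵥ forward P.σ θ.K θ.b (P.x s) n + θ.c) - P.y s) ^ 2)
    + P.α₁ * discreteReg P.normK P.τ₁ θ.K + P.α₂ * discreteReg P.normB P.τ₂ θ.b
    + P.α₃ * P.normW θ.W ^ 2 + P.α₄ * P.normC θ.c ^ 2

/-- The limiting objective `𝓔_∞`. -/
noncomputable def Einf (θ : Theta d m) : ℝ :=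
  (∑ s, P.normC (P.h (θ.W *ᵥ odeSolution P.σ θ.K θ.b (P.x s) 1 + θ.c) - P.y s) ^ 2)
    + P.α₁ * continuumReg P.normK P.τ₁ θ.K + P.α₂ * continuumReg P.normB P.τ₂ θ.b
    + P.α₃ * P.normW θ.W ^ 2 + P.α₄ * P.normC θ.c ^ 2

/-- The distance `d(θ⁽ⁿ⁾, θ)`. -/
noncomputable def dist {n : ℕ} (θn : ThetaN d m n) (θ : Theta d m) : ℝ :=
  stepDist P.normK θn.K θ.K + stepDist P.normB θn.b θ.b
    + P.normW (θn.W - θ.W) + P.normC (θn.c - θ.c)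

end Model

/-- Relative compactness of a sequence `u_n ∈ A_n` with respect to a distance between the spaces
`A_n` and a limit space `B`: every subsequence has a further subsequence converging to a point
of `B`. -/
def RelCompactSeq {A : ℕ → Type} {B : Type} (dist : ∀ n, A n → B → ℝ) (u : ∀ n, A n) : Prop :=
  ∀ φ : ℕ → ℕ, StrictMono φ → ∃ ψ : ℕ → ℕ, StrictMono ψ ∧ ∃ v : B,
    Tendsto (fun k => dist (φ (ψ k)) (u (φ (ψ k))) v) atTop (𝓝 0)

/-- `Γ`-convergence of `F_n : A_n → ℝ` to `F : B → ℝ` with respect to a distance between the spaces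
`A_n` and `B`: the liminf inequality and the existence of recovery sequences. -/
def GammaConverges {A : ℕ → Type} {B : Type} (dist : ∀ n, A n → B → ℝ)
    (F : ∀ n, A n → ℝ) (Finf : B → ℝ) : Prop :=
  ∀ v : B,
    (∀ u : ∀ n, A n, Tendsto (fun n => dist n (u n) v) atTop (𝓝 0) →
      (Finf v : EReal) ≤ liminf (fun n => (F n (u n) : EReal)) atTop) ∧
    ∃ u : ∀ n, A n, Tendsto (fun n => dist n (u n) v) atTop (𝓝 0) ∧
      limsup (fun n => (F n (u n) : EReal)) atTop ≤ (Finf v : EReal)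

end DeepLayer

/-!
Both the discrete and the continuous regularisers are studied through one functional, the energy
`∑ N(f(v_j) - f(u_j))² / (v_j - u_j)` of a function over finitely many non-overlapping intervals
`[u_j, v_j]` (`PartitionBound`). This avoids weak convergence of derivatives, and it works for an
arbitrary norm `N`.

* By Jensen's inequality, the energies of a pointwise limit of layers are bounded by the discrete
  energies `n ∑ N(a_i - a_{i-1})²` (`partitionBound_of_tendsto`).
* A function `f` whose energies are bounded by `C` is absolutely continuous by the Cauchy-Schwarz
  inequality, hence a primitive of some `g`. Fatou's lemma for the difference quotients over uniform
  partitions gives `∫ N(g)² ≤ C` (`PartitionBound.exists_eq_primitive`).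

Since the weak derivative of an `H¹` function is unique and its continuous representative is a
primitive of it (`MemH1.contRep_eq_primitive`, which rests on the lemma of du Bois-Reymond), these
two facts give the liminf inequality for the regularisers (`eventually_continuumReg_le`). The limsup
inequality is Jensen's inequality for the samples `f(i/n)` (`discreteReg_sample_le`).

Bounded discrete energy gives a discrete `1/2`-Hölder estimate (`layer_sub_le`). It has two
consequences: a diagonal argument produces convergent subsequences
(`exists_subseq_tendsto_stepDist`), and `L²` convergence of the layers improves to uniform
convergence (`eventually_layer_sub_le`). Under uniform convergence of the coefficients the network
is a consistent and stable Euler scheme, so its final states converge to those of the differential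
equation (`tendsto_forward`), and the data terms converge.

In the liminf inequality, the objectives are bounded only along the indices on which the liminf is
nearly attained. The intermediate results are therefore stated along an arbitrary filter below
`atTop`, to be applied to the restriction of `atTop` to these indices.

Minimisers at fixed depth exist by the direct method (`Model.exists_minimiser`).
-/

namespace DeepLayer

/-! ### Arbitrary norms on finite-dimensional spaces -/

namespace VNorm

section Algebra

variable {V : Type} [AddCommGroup V] [Module ℝ V] (N : VNorm V)

lemma nonneg (v : V) : 0 ≤ N v := apply_nonneg N.toSeminorm v

lemma add_le (v w : V) : N (v + w) ≤ N v + N w := map_add_le_add N.toSeminorm v w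

lemma map_zero : N 0 = 0 := _root_.map_zero N.toSeminorm

lemma smul (c : ℝ) (v : V) : N (c • v) = |c| * N v := map_smul_eq_mul N.toSeminorm c v

lemma sub_comm (v w : V) : N (v - w) = N (w - v) := map_sub_rev N.toSeminorm v w

lemma eq_zero {v : V} (h : N v = 0) : v = 0 := N.eq_zero' v h

lemma sum_le {ι : Type} (s : Finset ι) (f : ι → V) : N (∑ i ∈ s, f i) ≤ ∑ i ∈ s, N (f i) := by
  classical
  induction s using Finset.induction_on with
  | empty => simp [N.map_zero]
  | insert i s hi ih =>
    rw [Finset.sum_insert hi, Finset.sum_insert hi]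
    exact (N.add_le _ _).trans (by gcongr)

end Algebra

variable {V : Type} [NormedAddCommGroup V] [NormedSpace ℝ V] [FiniteDimensional ℝ V] (N : VNorm V)

lemma continuous : Continuous (fun v => N v) := by
  have h := (N.toSeminorm.convexOn).continuousOn isOpen_univ
  exact continuousOn_univ.mp h

/-- All norms on a finite-dimensional space are equivalent. -/
lemma exists_equiv : ∃ c : ℝ, 0 < c ∧ ∀ v, N v ≤ c * ‖v‖ ∧ ‖v‖ ≤ c * N v := by
  have : ProperSpace V := FiniteDimensional.proper ℝ V
  obtain ⟨A, hA⟩ := (isCompact_sphere (0 : V) 1).exists_bound_of_continuousOn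
    N.continuous.continuousOn
  obtain ⟨B, hB⟩ := (isCompact_sphere (0 : V) 1).exists_bound_of_continuousOn
    (f := fun v => (N v)⁻¹) (N.continuous.continuousOn.inv₀ (fun v hv h0 => by
      have := N.eq_zero h0
      simp [this] at hv))
  refine ⟨max 1 (max A B), by positivity, fun v => ?_⟩
  by_cases hv : v = 0
  · simp [hv, N.map_zero]
  have hv' : 0 < ‖v‖ := norm_pos_iff.mpr hv
  have hs : (‖v‖⁻¹ • v) ∈ Metric.sphere (0 : V) 1 := by
    simp [norm_smul, hv'.ne']
  have h1 := hA _ hs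
  have h2 := hB _ hs
  have hN : 0 < N v := lt_of_le_of_ne (N.nonneg v) (fun h => hv (N.eq_zero h.symm))
  rw [N.smul, abs_of_pos (inv_pos.mpr hv')] at h1 h2
  rw [Real.norm_of_nonneg (by positivity)] at h1 h2
  constructor
  · calc N v = (‖v‖⁻¹ * N v) * ‖v‖ := by field_simp
      _ ≤ max 1 (max A B) * ‖v‖ := by
        gcongr; exact h1.trans ((le_max_left _ _).trans (le_max_right _ _))
  · calc ‖v‖ = (‖v‖⁻¹ * N v)⁻¹ * N v := by field_simp
      _ ≤ max 1 (max A B) * N v := by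
        gcongr; exact h2.trans ((le_max_right _ _).trans (le_max_right _ _))

lemma tendsto_zero_iff {ι : Type} {l : Filter ι} {f : ι → V} :
    Tendsto (fun i => N (f i)) l (𝓝 0) ↔ Tendsto f l (𝓝 0) := by
  obtain ⟨c, hc, h⟩ := N.exists_equiv
  constructor
  · intro hf
    refine squeeze_zero_norm (fun i => (h (f i)).2) ?_
    simpa using hf.const_mul c
  · intro hf
    have := N.continuous.continuousAt.tendsto.comp hf
    simpa [N.map_zero, Function.comp_def] using this

end VNorm

/-! ### Functions in `H¹` as primitives of their weak derivatives -/

section Sobolev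

variable {V : Type} [NormedAddCommGroup V] [NormedSpace ℝ V]

lemma MemL2.integrableOn {E : Type} [NormedAddCommGroup E] {g : ℝ → E} (hg : MemL2 g) :
    IntegrableOn g (Icc 0 1) :=
  MemLp.integrable (q := 2) (by norm_num) hg

lemma intervalIntegrable_of_integrableOn {E : Type} [NormedAddCommGroup E] {g : ℝ → E}
    (hg : IntegrableOn g (Icc 0 1)) {s t : ℝ}
    (hs : s ∈ Icc (0 : ℝ) 1) (ht : t ∈ Icc (0 : ℝ) 1) : IntervalIntegrable g volume s t :=
  (hg.mono_set (uIcc_subset_Icc hs ht)).intervalIntegrable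

lemma integral_smul_of_tsupport_subset {φ : ℝ → ℝ} (hφ : tsupport φ ⊆ Ioo 0 1) (f : ℝ → V) :
    ∫ t in (0 : ℝ)..1, φ t • f t = ∫ t, φ t • f t := by
  rw [intervalIntegral.integral_of_le zero_le_one]
  refine setIntegral_eq_integral_of_forall_compl_eq_zero (fun x hx => ?_)
  rw [image_eq_zero_of_notMem_tsupport (fun h => hx (Ioo_subset_Ioc_self (hφ h))), zero_smul]

lemma ae_restrict_Icc_of_ae_Ioo {p : ℝ → Prop} (h : ∀ᵐ t, t ∈ Ioo (0 : ℝ) 1 → p t) :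
    ∀ᵐ t ∂(volume.restrict (Icc (0 : ℝ) 1)), p t := by
  rw [← Measure.restrict_congr_set (Ioo_ae_eq_Icc (a := (0 : ℝ)) (b := 1))]
  exact (ae_restrict_iff' measurableSet_Ioo).mpr h

/-- The fundamental lemma of the calculus of variations on `(0,1)`. -/
lemma ae_eq_zero_of_forall_test [CompleteSpace V] {f : ℝ → V} (hf : IntegrableOn f (Icc 0 1))
    (h : ∀ φ : ℝ → ℝ, ContDiff ℝ ∞ φ → HasCompactSupport φ → tsupport φ ⊆ Ioo 0 1 →
      ∫ t in (0 : ℝ)..1, φ t • f t = 0) :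
    ∀ᵐ t ∂(volume.restrict (Icc (0 : ℝ) 1)), f t = 0 := by
  refine ae_restrict_Icc_of_ae_Ioo (isOpen_Ioo.ae_eq_zero_of_integral_contDiff_smul_eq_zero
    (hf.mono_set Ioo_subset_Icc_self).locallyIntegrableOn (fun φ h1 h2 h3 => ?_))
  rw [← integral_smul_of_tsupport_subset h3]
  exact h φ h1 h2 h3

lemma intervalIntegrable_smul_of_continuous {φ : ℝ → ℝ} (hφ : Continuous φ) {f : ℝ → V}
    (hf : IntegrableOn f (Icc 0 1)) : IntervalIntegrable (fun t => φ t • f t) volume 0 1 :=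
  (intervalIntegrable_of_integrableOn hf (by simp) (by simp)).continuousOn_smul hφ.continuousOn

lemma IsWeakDeriv.ae_eq [CompleteSpace V] {f g₁ g₂ : ℝ → V} (h₁ : IsWeakDeriv f g₁)
    (h₂ : IsWeakDeriv f g₂) (hg₁ : IntegrableOn g₁ (Icc 0 1)) (hg₂ : IntegrableOn g₂ (Icc 0 1)) :
    g₁ =ᵐ[volume.restrict (Icc (0 : ℝ) 1)] g₂ := by
  have := ae_eq_zero_of_forall_test (hg₁.sub hg₂) (fun φ a b c => by
    have e := (h₁ φ a b c).symm.trans (h₂ φ a b c)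
    simp only [Pi.sub_apply, smul_sub]
    rw [intervalIntegral.integral_sub (intervalIntegrable_smul_of_continuous a.continuous hg₁)
      (intervalIntegrable_smul_of_continuous a.continuous hg₂), sub_eq_zero]
    exact neg_injective e)
  filter_upwards [this] with t ht
  exact sub_eq_zero.mp ht

lemma exists_Icc_of_isCompact_subset_Ioo {K : Set ℝ} (hK : IsCompact K) (h : K ⊆ Ioo 0 1) :
    ∃ a b : ℝ, 0 < a ∧ b < 1 ∧ K ⊆ Icc a b := by
  rcases K.eq_empty_or_nonempty with rfl | hne
  · exact ⟨1 / 2, 1 / 2, by norm_num, by norm_num, empty_subset _⟩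
  · obtain ⟨a, ha⟩ := hK.exists_isLeast hne
    obtain ⟨b, hb⟩ := hK.exists_isGreatest hne
    exact ⟨a, b, (h ha.1).1, (h hb.1).2, fun x hx => ⟨ha.2 hx, hb.2 hx⟩⟩

/-- A test function on `(0,1)` of zero mean is the derivative of a test function on `(0,1)`. -/
lemma exists_test_primitive {ρ : ℝ → ℝ} (hρ : ContDiff ℝ ∞ ρ) (hc : HasCompactSupport ρ)
    (hs : tsupport ρ ⊆ Ioo 0 1) (h0 : ∫ t in (0 : ℝ)..1, ρ t = 0) :
    ∃ φ : ℝ → ℝ, ContDiff ℝ ∞ φ ∧ HasCompactSupport φ ∧ tsupport φ ⊆ Ioo 0 1 ∧ deriv φ = ρ := by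
  obtain ⟨a, b, ha, hb, hab⟩ := exists_Icc_of_isCompact_subset_Ioo hc hs
  have hz : ∀ t, t ∉ Icc a b → ρ t = 0 := fun t ht =>
    image_eq_zero_of_notMem_tsupport (fun h => ht (hab h))
  have hd : ∀ t, HasDerivAt (fun t => ∫ s in (0 : ℝ)..t, ρ s) (ρ t) t := fun t =>
    intervalIntegral.integral_hasDerivAt_right (hρ.continuous.intervalIntegrable _ _)
      hρ.continuous.aestronglyMeasurable.stronglyMeasurableAtFilter hρ.continuous.continuousAt
  have hderiv : deriv (fun t => ∫ s in (0 : ℝ)..t, ρ s) = ρ := funext fun t => (hd t).deriv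
  have hsub : tsupport (fun t => ∫ s in (0 : ℝ)..t, ρ s) ⊆ Icc a b := by
    refine closure_minimal (fun t ht => ?_) isClosed_Icc
    by_contra hcon
    apply ht
    have hcon' : t < a ∨ b < t := by
      by_contra h; push Not at h; exact hcon ⟨h.1, h.2⟩
    rcases hcon' with h | h
    · refine intervalIntegral.integral_zero_ae (Eventually.of_forall (fun x hx => hz x ?_))
      rintro ⟨h1, -⟩
      have := hx.2
      rcases le_max_iff.mp this with h' | h' <;> linarith
    · have e := intervalIntegral.integral_add_adjacent_intervals
        (hρ.continuous.intervalIntegrable (μ := volume) 0 1) (hρ.continuous.intervalIntegrable 1 t)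
      have e2 : ∫ s in (1 : ℝ)..t, ρ s = 0 := by
        refine intervalIntegral.integral_zero_ae (Eventually.of_forall (fun x hx => hz x ?_))
        rintro ⟨-, h1⟩
        have := hx.1
        rcases min_lt_iff.mp this with h' | h' <;> linarith
      simp only
      rw [← e, h0, e2, add_zero]
  refine ⟨_, ?_, isCompact_Icc.of_isClosed_subset (isClosed_tsupport _) hsub,
    hsub.trans (Icc_subset_Ioo ha hb), hderiv⟩
  · rw [contDiff_infty_iff_deriv, hderiv]
    exact ⟨fun t => (hd t).differentiableAt, hρ⟩

/-- The lemma of du Bois-Reymond: a function with vanishing weak derivative is constant. -/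
lemma exists_ae_eq_const_of_forall_test_deriv [CompleteSpace V] {u : ℝ → V}
    (hu : IntegrableOn u (Icc 0 1))
    (h : ∀ φ : ℝ → ℝ, ContDiff ℝ ∞ φ → HasCompactSupport φ → tsupport φ ⊆ Ioo 0 1 →
      ∫ t in (0 : ℝ)..1, deriv φ t • u t = 0) :
    ∃ c : V, ∀ᵐ t ∂(volume.restrict (Icc (0 : ℝ) 1)), u t = c := by
  obtain ⟨η, hηs, hηc, hη, hηr, hη1⟩ := exists_contDiff_tsupport_subset (n := ⊤)
    (isOpen_Ioo.mem_nhds (show (1 / 2 : ℝ) ∈ Ioo (0 : ℝ) 1 by constructor <;> norm_num))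
  have hM : 0 < ∫ t in (0 : ℝ)..1, η t := by
    have := integral_smul_of_tsupport_subset hηs (fun _ => (1 : ℝ))
    simp only [smul_eq_mul, mul_one] at this
    rw [this]
    exact hη.continuous.integral_pos_of_hasCompactSupport_nonneg_nonzero hηc
      (fun t => (hηr ⟨t, rfl⟩).1) (x := 1 / 2) (by rw [hη1]; exact one_ne_zero)
  set M := ∫ t in (0 : ℝ)..1, η t with hMdef
  set c : V := M⁻¹ • ∫ t in (0 : ℝ)..1, η t • u t with hcdef
  refine ⟨c, ?_⟩
  have key := ae_eq_zero_of_forall_test (f := fun t => u t - c)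
    (hu.sub (integrable_const c)) (fun ψ hψ hψc hψs => ?_)
  · filter_upwards [key] with t ht
    exact sub_eq_zero.mp ht
  set I := ∫ t in (0 : ℝ)..1, ψ t with hI
  have hρc : HasCompactSupport (fun t => ψ t - (I * M⁻¹) * η t) :=
    hψc.sub (hηc.mul_left)
  have hρs : tsupport (fun t => ψ t - (I * M⁻¹) * η t) ⊆ Ioo 0 1 := by
    refine (tsupport_sub _ _).trans (union_subset hψs ?_)
    exact (tsupport_mul_subset_right).trans hηs
  have hii : ∀ f : ℝ → ℝ, Continuous f → IntervalIntegrable f volume 0 1 := fun f hf =>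
    hf.intervalIntegrable _ _
  -- Subtracting a multiple of the fixed bump `η` makes the mean of `ψ` vanish.
  have hρ0 : ∫ t in (0 : ℝ)..1, (ψ t - (I * M⁻¹) * η t) = 0 := by
    rw [intervalIntegral.integral_sub (hii _ hψ.continuous)
      (hii _ (hη.continuous.const_mul _)), intervalIntegral.integral_const_mul, ← hI, ← hMdef]
    field_simp
    ring
  obtain ⟨φ, h1, h2, h3, h4⟩ := exists_test_primitive
    (hψ.sub (contDiff_const.mul hη)) hρc hρs hρ0
  have h5 := h φ h1 h2 h3
  rw [h4] at h5
  have iψ := intervalIntegrable_smul_of_continuous hψ.continuous hu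
  have iη := intervalIntegrable_smul_of_continuous hη.continuous hu
  simp only [sub_smul, mul_smul] at h5
  have iη' : IntervalIntegrable (fun t => I • M⁻¹ • η t • u t) volume 0 1 := (iη.smul M⁻¹).smul I
  rw [intervalIntegral.integral_sub iψ iη', intervalIntegral.integral_smul,
    intervalIntegral.integral_smul, ← hcdef] at h5
  simp only [smul_sub]
  have iψc : IntervalIntegrable (fun t => ψ t • c) volume 0 1 :=
    (hψ.continuous.smul continuous_const).intervalIntegrable 0 1
  rw [intervalIntegral.integral_sub iψ iψc,
    intervalIntegral.integral_smul_const]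
  exact h5

lemma continuousOn_primitive {g : ℝ → V} (hg : IntegrableOn g (Icc 0 1)) (c : V) :
    ContinuousOn (fun t => c + ∫ s in (0 : ℝ)..t, g s) (Icc 0 1) := by
  refine continuousOn_const.add ?_
  have := intervalIntegral.continuousOn_primitive_interval (a := 0) (b := 1) (f := g) (μ := volume)
    (by rwa [uIcc_of_le zero_le_one])
  rwa [uIcc_of_le zero_le_one] at this

/-- Integration by parts, one coordinate at a time. -/
lemma isWeakDeriv_of_ae_eq_primitive [CompleteSpace V] {f g : ℝ → V}
    (hg : IntegrableOn g (Icc 0 1)) (c : V)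
    (hf : ∀ᵐ t ∂(volume.restrict (Icc (0 : ℝ) 1)), f t = c + ∫ s in (0 : ℝ)..t, g s) :
    IsWeakDeriv f g := by
  intro φ hφ hφc hφs
  have h01 : (0 : ℝ) ∈ Icc (0 : ℝ) 1 := by simp
  have hg01 : IntervalIntegrable g volume 0 1 := intervalIntegrable_of_integrableOn hg h01 (by simp)
  have hφ' : Continuous (deriv φ) := hφ.continuous_deriv (by simp)
  have hF : IntegrableOn (fun t => c + ∫ s in (0 : ℝ)..t, g s) (Icc 0 1) :=
    (continuousOn_primitive hg c).integrableOn_compact isCompact_Icc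
  have e1 : ∫ t in (0 : ℝ)..1, deriv φ t • f t
      = ∫ t in (0 : ℝ)..1, deriv φ t • (c + ∫ s in (0 : ℝ)..t, g s) := by
    refine intervalIntegral.integral_congr_ae_restrict ?_
    rw [uIoc_of_le zero_le_one]
    filter_upwards [ae_restrict_of_ae_restrict_of_subset Ioc_subset_Icc_self hf] with t ht
    rw [ht]
  rw [e1, SeparatingDual.eq_iff_forall_dual_eq (R := ℝ)]
  intro ℓ
  rw [map_neg, ← ℓ.intervalIntegral_comp_comm (intervalIntegrable_smul_of_continuous hφ' hF),
    ← ℓ.intervalIntegral_comp_comm (intervalIntegrable_smul_of_continuous hφ.continuous hg)]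
  simp only [map_smul, map_add, smul_eq_mul]
  have hℓg : IntervalIntegrable (fun t => ℓ (g t)) volume 0 1 :=
    (intervalIntegrable_iff_integrableOn_Ioc_of_le zero_le_one).mpr (ℓ.integrable_comp hg01.1)
  have hAC := hℓg.absolutelyContinuousOnInterval_intervalIntegral (c := 0) (by simp)
  have hφAC : AbsolutelyContinuousOnInterval φ 0 1 :=
    ContDiffOn.absolutelyContinuousOnInterval (hφ.of_le (by simp)).contDiffOn
  have hcAC : AbsolutelyContinuousOnInterval (fun _ : ℝ => ℓ c) 0 1 :=
    (LipschitzWith.const (ℓ c)).lipschitzOnWith.absolutelyContinuousOnInterval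
  have ibp := hφAC.integral_mul_deriv_eq_deriv_mul (hcAC.add hAC)
  have z0 : φ 0 = 0 := image_eq_zero_of_notMem_tsupport (fun h => by simpa using hφs h)
  have z1 : φ 1 = 0 := image_eq_zero_of_notMem_tsupport (fun h => by simpa using hφs h)
  rw [z0, z1, zero_mul, zero_mul, sub_zero, zero_sub] at ibp
  have e2 : ∫ t in (0 : ℝ)..1, φ t * ℓ (g t) = ∫ t in (0 : ℝ)..1, φ t *
      deriv ((fun _ => ℓ c) + fun x => ∫ v in (0 : ℝ)..x, ℓ (g v)) t := by
    refine intervalIntegral.integral_congr_ae ?_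
    filter_upwards [hℓg.ae_hasDerivAt_integral] with t ht htm
    have := (ht (uIoc_subset_uIcc htm) 0 (by simp)).const_add (ℓ c)
    rw [show ((fun _ => ℓ c) + fun x => ∫ v in (0 : ℝ)..x, ℓ (g v))
      = fun x => ℓ c + ∫ v in (0 : ℝ)..x, ℓ (g v) from rfl, this.deriv]
  rw [e2, ibp, neg_neg]
  refine intervalIntegral.integral_congr (fun t ht => ?_)
  rw [uIcc_of_le zero_le_one] at ht
  simp only [Pi.add_apply]
  rw [ℓ.intervalIntegral_comp_comm (intervalIntegrable_of_integrableOn hg h01 ht)]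

/-- A weakly differentiable function is almost everywhere a primitive of its weak derivative. -/
lemma IsWeakDeriv.exists_ae_eq_primitive [CompleteSpace V] {f g : ℝ → V} (h : IsWeakDeriv f g)
    (hf : IntegrableOn f (Icc 0 1)) (hg : IntegrableOn g (Icc 0 1)) :
    ∃ c : V, ∀ᵐ t ∂(volume.restrict (Icc (0 : ℝ) 1)), f t = c + ∫ s in (0 : ℝ)..t, g s := by
  have hF : IntegrableOn (fun t => (0 : V) + ∫ s in (0 : ℝ)..t, g s) (Icc 0 1) :=
    (continuousOn_primitive hg 0).integrableOn_compact isCompact_Icc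
  have hFw := isWeakDeriv_of_ae_eq_primitive hg 0 (f := fun t => (0 : V) + ∫ s in (0 : ℝ)..t, g s)
    (Eventually.of_forall fun _ => rfl)
  obtain ⟨c, hc⟩ := exists_ae_eq_const_of_forall_test_deriv (hf.sub hF) (fun φ a b d => by
    have hφ' : Continuous (deriv φ) := a.continuous_deriv (by simp)
    simp only [Pi.sub_apply, smul_sub]
    rw [intervalIntegral.integral_sub (intervalIntegrable_smul_of_continuous hφ' hf)
      (intervalIntegrable_smul_of_continuous hφ' hF), h φ a b d, hFw φ a b d, sub_self])
  refine ⟨c, ?_⟩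
  filter_upwards [hc] with t ht
  simp only [Pi.sub_apply, zero_add] at ht
  rw [← ht]; abel

lemma MemL2.of_continuousOn {E : Type} [NormedAddCommGroup E] {f : ℝ → E}
    (hf : ContinuousOn f (Icc 0 1)) : MemL2 f := by
  obtain ⟨C, hC⟩ := isCompact_Icc.exists_bound_of_continuousOn hf
  exact MemLp.of_bound (hf.aestronglyMeasurable_of_isCompact isCompact_Icc measurableSet_Icc) C
    ((ae_restrict_iff' measurableSet_Icc).mpr (Eventually.of_forall hC))

lemma memH1_of_eq_primitive [CompleteSpace V] {f g : ℝ → V} (hg : MemL2 g)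
    (hf : ∀ t ∈ Icc (0 : ℝ) 1, f t = f 0 + ∫ s in (0 : ℝ)..t, g s) : MemH1 f := by
  refine ⟨MemL2.of_continuousOn ((continuousOn_primitive hg.integrableOn (f 0)).congr hf), g, hg,
    isWeakDeriv_of_ae_eq_primitive hg.integrableOn (f 0) ?_⟩
  exact (ae_restrict_iff' measurableSet_Icc).mpr (Eventually.of_forall hf)

lemma MemH1.weakDeriv_spec {f : ℝ → V} (hf : MemH1 f) :
    MemL2 (weakDeriv f) ∧ IsWeakDeriv f (weakDeriv f) := by
  have h := hf.2
  simp only [weakDeriv, dif_pos h]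
  exact h.choose_spec

lemma MemH1.contRep_spec [CompleteSpace V] {f : ℝ → V} (hf : MemH1 f) :
    ContinuousOn (contRep f) (Icc 0 1) ∧ f =ᵐ[volume.restrict (Icc (0 : ℝ) 1)] contRep f := by
  have h : ∃ g : ℝ → V, ContinuousOn g (Icc 0 1) ∧ f =ᵐ[volume.restrict (Icc (0 : ℝ) 1)] g := by
    obtain ⟨c, hc⟩ := hf.weakDeriv_spec.2.exists_ae_eq_primitive hf.1.integrableOn
      hf.weakDeriv_spec.1.integrableOn
    exact ⟨_, continuousOn_primitive hf.weakDeriv_spec.1.integrableOn c, hc⟩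
  simp only [contRep, dif_pos h]
  exact h.choose_spec

/-- The fundamental theorem of calculus for `H¹` functions. -/
lemma MemH1.contRep_eq_primitive [CompleteSpace V] {f : ℝ → V} (hf : MemH1 f) :
    ∀ t ∈ Icc (0 : ℝ) 1, contRep f t = contRep f 0 + ∫ s in (0 : ℝ)..t, weakDeriv f s := by
  obtain ⟨c, hc⟩ := hf.weakDeriv_spec.2.exists_ae_eq_primitive hf.1.integrableOn
    hf.weakDeriv_spec.1.integrableOn
  have := Measure.eqOn_Icc_of_ae_eq volume zero_ne_one (hf.contRep_spec.2.symm.trans hc)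
    hf.contRep_spec.1 (continuousOn_primitive hf.weakDeriv_spec.1.integrableOn c)
  intro t ht
  rw [this ht, this (show (0 : ℝ) ∈ Icc (0 : ℝ) 1 by simp)]
  simp

/-- A primitive of an `L²` function that agrees with the continuous representative of `f`
identifies the weak derivative of `f`. -/
lemma MemH1.weakDeriv_ae_eq [CompleteSpace V] {f g : ℝ → V} (hf : MemH1 f) (hg : MemL2 g)
    (h : ∀ t ∈ Icc (0 : ℝ) 1, contRep f t = contRep f 0 + ∫ s in (0 : ℝ)..t, g s) :
    weakDeriv f =ᵐ[volume.restrict (Icc (0 : ℝ) 1)] g := by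
  refine hf.weakDeriv_spec.2.ae_eq (isWeakDeriv_of_ae_eq_primitive hg.integrableOn (contRep f 0) ?_)
    hf.weakDeriv_spec.1.integrableOn hg.integrableOn
  filter_upwards [hf.contRep_spec.2, ae_restrict_mem measurableSet_Icc] with t ht htm
  rw [ht, h t htm]

end Sobolev

/-! ### Discrete energies -/

section Discrete

variable {V : Type} [AddCommGroup V] [Module ℝ V] (N : VNorm V)

lemma sum_Ioc_sub_pred {G : Type} [AddCommGroup G] (b : ℕ → G) {i j : ℕ} (hij : i ≤ j) :
    ∑ k ∈ Finset.Ioc i j, (b k - b (k - 1)) = b j - b i := by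
  induction j, hij using Nat.le_induction with
  | base => simp
  | succ j hij ih => rw [Finset.sum_Ioc_succ_top (by omega), ih]; simp

/-- Jensen's inequality for the increments of a sequence. -/
lemma sq_sub_le_mul_sum (b : ℕ → V) {i j : ℕ} (hij : i ≤ j) :
    N (b j - b i) ^ 2 ≤ ((j : ℝ) - i) * ∑ k ∈ Finset.Ioc i j, N (b k - b (k - 1)) ^ 2 := by
  rw [← sum_Ioc_sub_pred b hij]
  calc N (∑ k ∈ Finset.Ioc i j, (b k - b (k - 1))) ^ 2
      ≤ (∑ k ∈ Finset.Ioc i j, N (b k - b (k - 1))) ^ 2 :=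
        pow_le_pow_left₀ (N.nonneg _) (N.sum_le _ _) 2
    _ ≤ (Finset.Ioc i j).card * ∑ k ∈ Finset.Ioc i j, N (b k - b (k - 1)) ^ 2 :=
        sq_sum_le_card_mul_sum_sq
    _ = _ := by rw [Nat.card_Ioc, Nat.cast_sub hij]

/-- Jensen's inequality on each of finitely many disjoint blocks of indices. -/
lemma sum_sq_sub_div_le (b : ℕ → V) (n : ℕ) (s : Finset ℕ) (u v : ℕ → ℕ)
    (huv : ∀ j ∈ s, u j ≤ v j ∧ v j < n)
    (hd : ∀ i ∈ s, ∀ j ∈ s, i ≠ j → v i ≤ u j ∨ v j ≤ u i) :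
    ∑ j ∈ s, N (b (v j) - b (u j)) ^ 2 / ((v j : ℝ) - u j)
      ≤ ∑ k ∈ Finset.Ico 1 n, N (b k - b (k - 1)) ^ 2 := by
  have hdisj : (s : Set ℕ).PairwiseDisjoint (fun j => Finset.Ioc (u j) (v j)) := by
    intro i hi j hj hij
    rw [Function.onFun, Finset.disjoint_left]
    intro k hk hk'
    rw [Finset.mem_Ioc] at hk hk'
    have := hd i hi j hj hij
    omega
  calc ∑ j ∈ s, N (b (v j) - b (u j)) ^ 2 / ((v j : ℝ) - u j)
      ≤ ∑ j ∈ s, ∑ k ∈ Finset.Ioc (u j) (v j), N (b k - b (k - 1)) ^ 2 := by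
        refine Finset.sum_le_sum (fun j hj => ?_)
        have h0 : (0 : ℝ) ≤ (v j : ℝ) - u j := by
          have := (huv j hj).1; rw [sub_nonneg]; exact_mod_cast this
        refine div_le_of_le_mul₀ h0 (Finset.sum_nonneg fun _ _ => sq_nonneg _) ?_
        rw [mul_comm]
        exact sq_sub_le_mul_sum N b (huv j hj).1
    _ = ∑ k ∈ s.biUnion (fun j => Finset.Ioc (u j) (v j)), N (b k - b (k - 1)) ^ 2 :=
        (Finset.sum_biUnion hdisj).symm
    _ ≤ _ := by
        refine Finset.sum_le_sum_of_subset_of_nonneg (fun k hk => ?_) (fun _ _ _ => sq_nonneg _)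
        rw [Finset.mem_biUnion] at hk
        obtain ⟨j, hj, hk⟩ := hk
        have := huv j hj
        rw [Finset.mem_Ioc] at hk
        rw [Finset.mem_Ico]
        omega

variable {n : ℕ} (a : Fin n → V)

lemma incr_energy_le {τ C : ℝ} (hτ : 0 ≤ τ) (h : discreteReg N τ a ≤ C) :
    n * (∑ i ∈ Finset.Ico 1 n, N (layer a i - layer a (i - 1)) ^ 2) ≤ C := by
  have : 0 ≤ τ * N (layer a 0) ^ 2 := by positivity
  unfold discreteReg at h
  linarith

lemma discreteReg_nonneg {τ : ℝ} (hτ : 0 ≤ τ) : 0 ≤ discreteReg N τ a := by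
  unfold discreteReg
  have : 0 ≤ ∑ i ∈ Finset.Ico 1 n, N (layer a i - layer a (i - 1)) ^ 2 :=
    Finset.sum_nonneg fun _ _ => sq_nonneg _
  positivity

/-- The discrete `1/2`-Hölder estimate. -/
lemma layer_sub_sq_le {τ C : ℝ} (hτ : 0 ≤ τ) (h : discreteReg N τ a ≤ C) {i j : ℕ} (hij : i ≤ j)
    (hj : j < n) : N (layer a j - layer a i) ^ 2 ≤ C * (((j : ℝ) - i) / n) := by
  have hn : (0 : ℝ) < n := by exact_mod_cast (by omega : 0 < n)
  have h1 := sq_sub_le_mul_sum N (layer a) hij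
  have h2 : ∑ k ∈ Finset.Ioc i j, N (layer a k - layer a (k - 1)) ^ 2
      ≤ ∑ k ∈ Finset.Ico 1 n, N (layer a k - layer a (k - 1)) ^ 2 := by
    refine Finset.sum_le_sum_of_subset_of_nonneg (fun k hk => ?_) (fun _ _ _ => sq_nonneg _)
    rw [Finset.mem_Ioc] at hk
    rw [Finset.mem_Ico]
    omega
  have h3 := incr_energy_le N a hτ h
  have h0 : (0 : ℝ) ≤ (j : ℝ) - i := by rw [sub_nonneg]; exact_mod_cast hij
  calc _ ≤ ((j : ℝ) - i) * (C / n) := by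
        refine h1.trans (mul_le_mul_of_nonneg_left (h2.trans ?_) h0)
        rw [le_div_iff₀ hn]; linarith
    _ = _ := by ring

lemma layer_sub_le {τ C : ℝ} (hτ : 0 ≤ τ) (h : discreteReg N τ a ≤ C) {i j : ℕ}
    (hi : i < n) (hj : j < n) : N (layer a j - layer a i) ≤ √(C * (|(j : ℝ) - i| / n)) := by
  refine Real.le_sqrt_of_sq_le ?_
  rcases le_total i j with hij | hij
  · rw [abs_of_nonneg (by rw [sub_nonneg]; exact_mod_cast hij)]
    exact layer_sub_sq_le N a hτ h hij hj
  · rw [abs_sub_comm, abs_of_nonneg (by rw [sub_nonneg]; exact_mod_cast hij), N.sub_comm]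
    exact layer_sub_sq_le N a hτ h hij hi

lemma layer_le {τ C : ℝ} (hτ : 0 < τ) (h : discreteReg N τ a ≤ C) (i : ℕ) :
    N (layer a i) ≤ √C + √(C / τ) := by
  by_cases hi : i < n
  · have hn : (0 : ℝ) < n := by exact_mod_cast (by omega : 0 < n)
    have hC : 0 ≤ C := (discreteReg_nonneg N a hτ.le).trans h
    have h1 := layer_sub_le N a hτ.le h (i := 0) (j := i) (by omega) hi
    have h2 : N (layer a 0) ≤ √(C / τ) := by
      refine Real.le_sqrt_of_sq_le ?_
      rw [le_div_iff₀ hτ]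
      have h3 : 0 ≤ ∑ i ∈ Finset.Ico 1 n, N (layer a i - layer a (i - 1)) ^ 2 :=
        Finset.sum_nonneg fun _ _ => sq_nonneg _
      have h4 : 0 ≤ n * ∑ i ∈ Finset.Ico 1 n, N (layer a i - layer a (i - 1)) ^ 2 := by positivity
      unfold discreteReg at h
      linarith
    have h3 : √(C * (|(i : ℝ) - (0 : ℕ)| / n)) ≤ √C := by
      refine Real.sqrt_le_sqrt (mul_le_of_le_one_right hC ?_)
      rw [div_le_one hn, Nat.cast_zero, sub_zero, abs_of_nonneg (by positivity)]
      exact_mod_cast hi.le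
    calc N (layer a i) = N ((layer a i - layer a 0) + layer a 0) := by rw [sub_add_cancel]
      _ ≤ _ := (N.add_le _ _).trans (add_le_add (h1.trans h3) h2)
  · simp only [layer, dif_neg hi, N.map_zero]
    positivity

end Discrete

/-! ### Step functions -/

section Step

variable {V : Type} [NormedAddCommGroup V] {n : ℕ} (a : Fin n → V)

lemma stronglyMeasurable_stepExt : StronglyMeasurable (stepExt a) :=
  (StronglyMeasurable.of_discrete (f := layer a)).comp_measurable
    (Nat.measurable_floor.comp (measurable_const_mul (n : ℝ)))

lemma exists_bound_layer : ∃ C : ℝ, ∀ i, ‖layer a i‖ ≤ C := by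
  refine ⟨∑ j, ‖a j‖, fun i => ?_⟩
  unfold layer
  split_ifs with h
  · exact Finset.single_le_sum (f := fun j => ‖a j‖) (fun _ _ => norm_nonneg _)
      (Finset.mem_univ _)
  · rw [norm_zero]
    exact Finset.sum_nonneg fun _ _ => norm_nonneg _

lemma memL2_stepExt : MemL2 (stepExt a) := by
  obtain ⟨C, hC⟩ := exists_bound_layer a
  exact MemLp.of_bound (stronglyMeasurable_stepExt a).aestronglyMeasurable C
    (Eventually.of_forall fun t => hC _)

lemma stepExt_eq_layer {i : ℕ} (hn : 0 < n) {t : ℝ} (h1 : (i : ℝ) / n ≤ t)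
    (h2 : t < ((i : ℝ) + 1) / n) : stepExt a t = layer a i := by
  have hn' : (0 : ℝ) < n := by exact_mod_cast hn
  unfold stepExt
  congr 1
  have h0 : 0 ≤ t := le_trans (by positivity) h1
  rw [Nat.floor_eq_iff (by positivity)]
  rw [div_le_iff₀ hn'] at h1
  rw [lt_div_iff₀ hn'] at h2
  constructor <;> linarith

lemma integrableOn_comp_stepExt {F : V → ℝ} (hF : Continuous F) (s : Set ℝ)
    (hs : volume s ≠ ⊤) : IntegrableOn (fun t => F (stepExt a t)) s := by
  have hb : ∃ C : ℝ, ∀ i, ‖F (layer a i)‖ ≤ C := by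
    refine ⟨∑ j, ‖F (a j)‖ + ‖F 0‖, fun i => ?_⟩
    have h0 : 0 ≤ ∑ j, ‖F (a j)‖ := Finset.sum_nonneg fun _ _ => norm_nonneg _
    unfold layer
    split_ifs with h
    · have := Finset.single_le_sum (f := fun j => ‖F (a j)‖) (fun _ _ => norm_nonneg _)
        (Finset.mem_univ ⟨i, h⟩)
      have := norm_nonneg (F 0)
      linarith
    · linarith
  obtain ⟨C, hC⟩ := hb
  exact Measure.integrableOn_of_bounded hs
    (hF.comp_stronglyMeasurable (stronglyMeasurable_stepExt a)).aestronglyMeasurable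
    (M := C) (Eventually.of_forall fun t => hC _)

lemma integral_comp_stepExt (hn : 0 < n) {F : V → ℝ} (hF : Continuous F) :
    ∫ t in (0 : ℝ)..1, F (stepExt a t) = ∑ i ∈ Finset.range n, (1 / (n : ℝ)) * F (layer a i) := by
  have hn' : (0 : ℝ) < n := by exact_mod_cast hn
  have h := intervalIntegral.sum_integral_adjacent_intervals
    (f := fun t => F (stepExt a t)) (μ := volume) (a := fun k : ℕ => (k : ℝ) / n) (n := n)
    (fun k _ => (integrableOn_comp_stepExt a hF _
      (isCompact_uIcc.measure_lt_top.ne)).intervalIntegrable)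
  simp only [Nat.cast_zero, zero_div, div_self hn'.ne'] at h
  rw [← h]
  refine Finset.sum_congr rfl (fun k _ => ?_)
  have hk : (k : ℝ) / n ≤ ((k + 1 : ℕ) : ℝ) / n := by gcongr; simp
  have e : ∫ t in (k : ℝ) / n..((k + 1 : ℕ) : ℝ) / n, F (stepExt a t)
      = ∫ t in (k : ℝ) / n..((k + 1 : ℕ) : ℝ) / n, F (layer a k) := by
    rw [intervalIntegral.integral_of_le hk, intervalIntegral.integral_of_le hk,
      ← integral_Ico_eq_integral_Ioc, ← integral_Ico_eq_integral_Ioc]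
    refine setIntegral_congr_fun measurableSet_Ico (fun t ht => ?_)
    rw [stepExt_eq_layer a hn ht.1 (by have := ht.2; push_cast at this; exact this)]
  rw [e, intervalIntegral.integral_const, smul_eq_mul]
  congr 1
  push_cast
  ring

end Step

/-! ### Functions of finite energy -/

section Energy

variable {V : Type} [NormedAddCommGroup V] [NormedSpace ℝ V]

/-- The energies `∑ N(f(v_j) - f(u_j))² / (v_j - u_j)` over finite families of non-overlapping
intervals `[u_j, v_j]` in `[0,1]` are bounded by `C`. -/
def PartitionBound (N : VNorm V) (f : ℝ → V) (C : ℝ) : Prop :=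
  ∀ (s : Finset ℕ) (u v : ℕ → ℝ), (∀ j ∈ s, 0 ≤ u j ∧ u j < v j ∧ v j ≤ 1) →
    (∀ i ∈ s, ∀ j ∈ s, i ≠ j → v i ≤ u j ∨ v j ≤ u i) →
    ∑ j ∈ s, N (f (v j) - f (u j)) ^ 2 / (v j - u j) ≤ C

lemma PartitionBound.nonneg {N : VNorm V} {f : ℝ → V} {C : ℝ} (h : PartitionBound N f C) :
    0 ≤ C := by
  simpa using h ∅ 0 0 (by simp) (by simp)

/-- Difference quotients over small intervals around `t` converge to the derivative at `t`. -/
lemma tendsto_quotient_of_hasDerivAt {f : ℝ → V} {f' : V} {t : ℝ} (hf : HasDerivAt f f' t)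
    {u v : ℕ → ℝ} (hu : Tendsto u atTop (𝓝 t)) (hv : Tendsto v atTop (𝓝 t))
    (h : ∀ᶠ k in atTop, u k ≤ t ∧ t ≤ v k ∧ u k < v k) :
    Tendsto (fun k => (v k - u k)⁻¹ • (f (v k) - f (u k))) atTop (𝓝 f') := by
  rw [Metric.tendsto_atTop']
  intro ε hε
  have hb := (hasDerivAt_iff_isLittleO.mp hf).bound (half_pos hε)
  have := (hu.eventually hb).and ((hv.eventually hb).and h)
  rw [eventually_atTop] at this
  obtain ⟨K, hK⟩ := this
  refine ⟨K, fun k hk => ?_⟩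
  obtain ⟨h1, h2, h3, h4, h5⟩ := hK k hk.le
  rw [dist_eq_norm]
  have hpos : 0 < v k - u k := by linarith
  rw [Real.norm_of_nonpos (by linarith)] at h1
  rw [Real.norm_of_nonneg (by linarith)] at h2
  have e : (v k - u k)⁻¹ • (f (v k) - f (u k)) - f'
      = (v k - u k)⁻¹ • ((f (v k) - f t - (v k - t) • f') - (f (u k) - f t - (u k - t) • f')) := by
    have : f' = (v k - u k)⁻¹ • ((v k - u k) • f') := by
      rw [smul_smul, inv_mul_cancel₀ hpos.ne', one_smul]
    nth_rewrite 1 [this]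
    rw [← smul_sub]
    congr 1
    module
  rw [e, norm_smul, norm_inv, Real.norm_of_nonneg hpos.le, inv_mul_lt_iff₀ hpos]
  calc _ ≤ ε / 2 * (v k - t) + ε / 2 * -(u k - t) := (norm_sub_le _ _).trans (add_le_add h2 h1)
    _ = ε / 2 * (v k - u k) := by ring
    _ < (v k - u k) * ε := by nlinarith

variable [FiniteDimensional ℝ V]

/-- By the Cauchy-Schwarz inequality, a bound on the partition energies gives absolute
continuity. -/
lemma PartitionBound.absolutelyContinuous {N : VNorm V} {f : ℝ → V} {C : ℝ}
    (h : PartitionBound N f C) (ℓ : V →L[ℝ] ℝ) :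
    AbsolutelyContinuousOnInterval (fun t => ℓ (f t)) 0 1 := by
  obtain ⟨c, hc, hN⟩ := N.exists_equiv
  have hC := h.nonneg
  set A := ‖ℓ‖ * c with hA
  have hA0 : 0 ≤ A := by positivity
  rw [absolutelyContinuousOnInterval_iff]
  intro ε hε
  refine ⟨(ε / (A * √C + 1)) ^ 2, by positivity, ?_⟩
  rintro ⟨k, I⟩ hI hlen
  simp only [AbsolutelyContinuousOnInterval.disjWithin, uIcc_of_le zero_le_one,
    mem_ofPred_eq] at hI hlen ⊢
  obtain ⟨hI1, hI2⟩ := hI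
  -- Reorder the endpoints of the intervals and discard the degenerate intervals.
  set s := (Finset.range k).filter (fun i => (I i).1 ≠ (I i).2) with hs
  set u : ℕ → ℝ := fun i => min (I i).1 (I i).2
  set v : ℕ → ℝ := fun i => max (I i).1 (I i).2
  have huv : ∀ i ∈ s, u i < v i := fun i hi => by
    rw [hs, Finset.mem_filter] at hi
    exact min_lt_max.mpr hi.2
  have hpb := h s u v (fun i hi => by
    have := huv i hi
    rw [hs, Finset.mem_filter] at hi
    have h1 := hI1 i hi.1
    exact ⟨le_min h1.1.1 h1.2.1, this, max_le h1.1.2 h1.2.2⟩) (fun i hi j hj hij => by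
    have hi' := huv i hi
    have hj' := huv j hj
    rw [hs, Finset.mem_filter] at hi hj
    have := hI2 hi.1 hj.1 hij
    simp only [Function.onFun, uIoc] at this
    rw [Ioc_disjoint_Ioc] at this
    change min (v i) (v j) ≤ max (u i) (u j) at this
    rcases min_le_iff.mp this with h1 | h1 <;> rcases le_max_iff.mp h1 with h2 | h2
    · linarith
    · exact Or.inl h2
    · exact Or.inr h2
    · linarith)
  have hvu : ∀ i, v i - u i = dist (I i).1 (I i).2 := fun i => by
    rw [Real.dist_eq]; exact max_sub_min_eq_abs' _ _
  have hfvu : ∀ i, dist (ℓ (f (I i).1)) (ℓ (f (I i).2)) ≤ A * N (f (v i) - f (u i)) := fun i => by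
    rw [dist_eq_norm, ← map_sub]
    have e : N (f (I i).1 - f (I i).2) = N (f (v i) - f (u i)) := by
      rcases le_total (I i).1 (I i).2 with h1 | h1
      · simp only [u, v, min_eq_left h1, max_eq_right h1]; exact N.sub_comm _ _
      · simp only [u, v, min_eq_right h1, max_eq_left h1]
    rw [← e, hA, mul_assoc]
    refine (ℓ.le_opNorm _).trans ?_
    gcongr
    exact (hN _).2
  have hcs : (∑ i ∈ s, N (f (v i) - f (u i))) ^ 2 ≤ C * ∑ i ∈ s, (v i - u i) := by
    refine (Finset.sum_sq_le_sum_mul_sum_of_sq_le_mul s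
      (f := fun i => N (f (v i) - f (u i)) ^ 2 / (v i - u i)) (g := fun i => v i - u i)
      (fun i hi => ?_) (fun i hi => ?_) (fun i hi => ?_)).trans ?_
    · have := huv i hi
      exact div_nonneg (sq_nonneg _) (by linarith)
    · linarith [huv i hi]
    · have := huv i hi
      rw [div_mul_cancel₀ _ (by linarith)]
    · exact mul_le_mul_of_nonneg_right hpb (Finset.sum_nonneg fun i hi => by linarith [huv i hi])
  have hsum : ∑ i ∈ s, (v i - u i) ≤ ∑ i ∈ Finset.range k, dist (I i).1 (I i).2 := by
    simp only [hvu]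
    exact Finset.sum_le_sum_of_subset_of_nonneg (Finset.filter_subset _ _)
      (fun _ _ _ => dist_nonneg)
  have hs0 : 0 ≤ ∑ i ∈ s, N (f (v i) - f (u i)) := Finset.sum_nonneg fun _ _ => N.nonneg _
  have hδ : 0 < ε / (A * √C + 1) := by positivity
  have hmain : ∑ i ∈ s, N (f (v i) - f (u i)) ≤ √C * (ε / (A * √C + 1)) := by
    refine abs_le_of_sq_le_sq' ?_ (by positivity) |>.2
    rw [mul_pow, Real.sq_sqrt hC]
    exact hcs.trans (mul_le_mul_of_nonneg_left (hsum.trans hlen.le) hC)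
  calc ∑ i ∈ Finset.range k, dist (ℓ (f (I i).1)) (ℓ (f (I i).2))
      = ∑ i ∈ s, dist (ℓ (f (I i).1)) (ℓ (f (I i).2)) := by
        rw [hs, Finset.sum_filter]
        refine Finset.sum_congr rfl (fun i _ => ?_)
        split_ifs with h1
        · rfl
        · rw [not_not.mp h1, dist_self]
    _ ≤ ∑ i ∈ s, A * N (f (v i) - f (u i)) := Finset.sum_le_sum fun i _ => hfvu i
    _ = A * ∑ i ∈ s, N (f (v i) - f (u i)) := by rw [Finset.mul_sum]
    _ ≤ A * (√C * (ε / (A * √C + 1))) := by gcongr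
    _ = ε * (A * √C / (A * √C + 1)) := by ring
    _ < ε * 1 := by
        refine mul_lt_mul_of_pos_left ?_ hε
        rw [div_lt_one (by positivity)]
        linarith
    _ = ε := mul_one ε

/-- A vector-valued fundamental theorem of calculus, obtained coordinate by coordinate. -/
lemma exists_eq_primitive_of_absolutelyContinuous {f : ℝ → V}
    (h : ∀ ℓ : V →L[ℝ] ℝ, AbsolutelyContinuousOnInterval (fun t => ℓ (f t)) 0 1) :
    ∃ g : ℝ → V, IntegrableOn g (Icc 0 1) ∧
      ∀ t ∈ Icc (0 : ℝ) 1, f t = f 0 + ∫ s in (0 : ℝ)..t, g s := by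
  let b := Module.finBasis ℝ V
  let ℓ : Fin (Module.finrank ℝ V) → V →L[ℝ] ℝ := fun i =>
    LinearMap.toContinuousLinearMap (b.coord i)
  have hi : ∀ i, IntegrableOn (fun t => deriv (fun r => ℓ i (f r)) t • b i) (Icc 0 1) := fun i => by
    have := (h (ℓ i)).intervalIntegrable_deriv
    rw [intervalIntegrable_iff_integrableOn_Icc_of_le zero_le_one] at this
    exact this.smul_const _
  refine ⟨fun t => ∑ i, deriv (fun r => ℓ i (f r)) t • b i,
    integrable_finsetSum _ (fun i _ => hi i), fun t ht => ?_⟩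
  have h0 : (0 : ℝ) ∈ Icc (0 : ℝ) 1 := by simp
  rw [intervalIntegral.integral_finsetSum
    (fun i _ => intervalIntegrable_of_integrableOn (hi i) h0 ht)]
  have hft : ∀ r, f r = ∑ i, ℓ i (f r) • b i := fun r => (b.sum_repr (f r)).symm
  rw [hft t, hft 0, ← Finset.sum_add_distrib]
  refine Finset.sum_congr rfl (fun i _ => ?_)
  rw [intervalIntegral.integral_smul_const, ← add_smul,
    ((h (ℓ i)).mono (c := 0) (d := t) ?_).integral_deriv_eq_sub]
  · congr 1; ring
  · rw [uIcc_of_le zero_le_one]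
    exact uIcc_subset_Icc h0 ht

/-- A function of finite energy is a primitive of an `L²` function, with the same bound on its
energy. The energy bound follows from Fatou's lemma, applied to the difference quotients over the
uniform partitions of `[0,1]`. -/
theorem PartitionBound.exists_eq_primitive {N : VNorm V} {f : ℝ → V} {C : ℝ}
    (h : PartitionBound N f C) :
    ∃ g : ℝ → V, MemL2 g ∧ (∀ t ∈ Icc (0 : ℝ) 1, f t = f 0 + ∫ s in (0 : ℝ)..t, g s) ∧
      ∫ t in (0 : ℝ)..1, N (g t) ^ 2 ≤ C := by
  obtain ⟨g, hg, hfg⟩ := exists_eq_primitive_of_absolutelyContinuous h.absolutelyContinuous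
  have hC := h.nonneg
  have hNc : Continuous fun v : V => N v ^ 2 := N.continuous.pow 2
  -- `stepExt (q k) t` is the difference quotient over the interval of length `1 / k` around `t`.
  let q : (k : ℕ) → Fin k → V := fun k j => (((j : ℝ) + 1) / k - (j : ℝ) / k)⁻¹ •
    (f (((j : ℝ) + 1) / k) - f ((j : ℝ) / k))
  have hconv : ∀ᵐ t ∂(volume.restrict (Icc (0 : ℝ) 1)),
      Tendsto (fun k => stepExt (q k) t) atTop (𝓝 (g t)) := by
    refine ae_restrict_Icc_of_ae_Ioo ?_
    filter_upwards [(intervalIntegrable_of_integrableOn hg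
      (show (0 : ℝ) ∈ Icc (0 : ℝ) 1 by simp) (show (1 : ℝ) ∈ Icc (0 : ℝ) 1 by
        simp)).ae_hasDerivAt_integral] with t ht htm
    have hd := (ht (by rw [uIcc_of_le zero_le_one]; exact Ioo_subset_Icc_self htm) 0
      (by simp)).const_add (f 0)
    have hd' : HasDerivAt f (g t) t := hd.congr_of_eventuallyEq (by
      filter_upwards [isOpen_Ioo.mem_nhds htm] with r hr
      exact hfg r (Ioo_subset_Icc_self hr))
    have hlim0 : Tendsto (fun k : ℕ => ((⌊(k : ℝ) * t⌋₊ : ℝ)) / k) atTop (𝓝 t) := by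
      have := (tendsto_nat_floor_mul_div_atTop htm.1.le).comp tendsto_natCast_atTop_atTop
      simpa [Function.comp_def, mul_comm] using this
    have hlim1 : Tendsto (fun k : ℕ => ((⌊(k : ℝ) * t⌋₊ : ℝ) + 1) / k) atTop (𝓝 t) := by
      have := hlim0.add (tendsto_one_div_atTop_nhds_zero_nat (𝕜 := ℝ))
      simpa [add_div] using this
    have hpos : ∀ᶠ k : ℕ in atTop, (0 : ℝ) < k := by
      filter_upwards [eventually_gt_atTop 0] with k hk
      exact_mod_cast hk
    have := tendsto_quotient_of_hasDerivAt hd' hlim0 hlim1 (by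
      filter_upwards [hpos] with k hk
      have h1 := Nat.floor_le (show 0 ≤ (k : ℝ) * t from mul_nonneg hk.le htm.1.le)
      have h2 := Nat.lt_floor_add_one ((k : ℝ) * t)
      refine ⟨?_, ?_, ?_⟩
      · rw [div_le_iff₀ hk]; linarith
      · rw [le_div_iff₀ hk]; linarith
      · gcongr; linarith)
    refine this.congr' ?_
    filter_upwards [hpos] with k hk
    have hfl : ⌊(k : ℝ) * t⌋₊ < k := by
      rw [Nat.floor_lt (mul_nonneg hk.le htm.1.le)]
      have := htm.2
      nlinarith
    simp only [stepExt, layer, dif_pos hfl, q]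
  have hint : ∀ k : ℕ, 0 < k →
      ∫⁻ t in Icc (0 : ℝ) 1, ENNReal.ofReal (N (stepExt (q k) t) ^ 2) ≤ ENNReal.ofReal C := by
    intro k hk
    have hk' : (0 : ℝ) < k := by exact_mod_cast hk
    rw [← ofReal_integral_eq_lintegral_ofReal
      (integrableOn_comp_stepExt (q k) hNc _ (by simp))
      (Eventually.of_forall fun _ => sq_nonneg _), integral_Icc_eq_integral_Ioc,
      ← intervalIntegral.integral_of_le zero_le_one, integral_comp_stepExt (q k) hk hNc]
    refine ENNReal.ofReal_le_ofReal ?_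
    have hpb := h (Finset.range k) (fun j => (j : ℝ) / k) (fun j => ((j : ℝ) + 1) / k)
      (fun j hj => by
        rw [Finset.mem_range] at hj
        refine ⟨by positivity, by gcongr; linarith, ?_⟩
        rw [div_le_one hk']
        exact_mod_cast hj) (fun i _ j _ hij => by
        rcases lt_or_gt_of_ne hij with h1 | h1
        · left; gcongr; exact_mod_cast h1
        · right; gcongr; exact_mod_cast h1)
    refine le_trans (le_of_eq (Finset.sum_congr rfl fun j hj => ?_)) hpb
    rw [Finset.mem_range] at hj
    simp only [layer, dif_pos hj, q]
    have e : ((j : ℝ) + 1) / k - (j : ℝ) / k = 1 / k := by ring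
    simp only [e, N.smul]
    rw [abs_of_pos (by positivity)]
    field_simp
  have hfatou : ∫⁻ t in Icc (0 : ℝ) 1, ENNReal.ofReal (N (g t) ^ 2) ≤ ENNReal.ofReal C := by
    calc ∫⁻ t in Icc (0 : ℝ) 1, ENNReal.ofReal (N (g t) ^ 2)
        = ∫⁻ t in Icc (0 : ℝ) 1,
            liminf (fun k => ENNReal.ofReal (N (stepExt (q k) t) ^ 2)) atTop := by
          refine lintegral_congr_ae ?_
          filter_upwards [hconv] with t ht
          exact ((ENNReal.continuous_ofReal.comp hNc).continuousAt.tendsto.comp ht).liminf_eq.symm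
      _ ≤ liminf (fun k => ∫⁻ t in Icc (0 : ℝ) 1, ENNReal.ofReal (N (stepExt (q k) t) ^ 2))
            atTop := lintegral_liminf_le (fun k =>
          ENNReal.measurable_ofReal.comp
            (hNc.comp_stronglyMeasurable (stronglyMeasurable_stepExt (q k))).measurable)
      _ ≤ ENNReal.ofReal C := by
          refine liminf_le_of_frequently_le' (Eventually.frequently ?_)
          filter_upwards [eventually_gt_atTop 0] with k hk
          exact hint k hk
  have hgm : AEStronglyMeasurable g (volume.restrict (Icc (0 : ℝ) 1)) := hg.1
  have hNg : IntegrableOn (fun t => N (g t) ^ 2) (Icc 0 1) := by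
    refine ⟨hNc.comp_aestronglyMeasurable hgm, ?_⟩
    rw [hasFiniteIntegral_iff_ofReal (Eventually.of_forall fun _ => sq_nonneg _)]
    exact hfatou.trans_lt ENNReal.ofReal_lt_top
  refine ⟨g, ?_, hfg, ?_⟩
  · obtain ⟨c, hc, hN⟩ := N.exists_equiv
    refine (memLp_two_iff_integrable_sq_norm hgm).mpr ?_
    refine (hNg.const_mul (c ^ 2)).mono' (hgm.norm.pow 2) (Eventually.of_forall fun t => ?_)
    rw [Real.norm_of_nonneg (by positivity), ← mul_pow]
    exact pow_le_pow_left₀ (norm_nonneg _) (hN _).2 2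
  · rw [intervalIntegral.integral_of_le zero_le_one, ← integral_Icc_eq_integral_Ioc,
      integral_eq_lintegral_of_nonneg_ae (Eventually.of_forall fun _ => sq_nonneg _) hNg.1]
    exact ENNReal.toReal_le_of_le_ofReal hC hfatou

end Energy

/-! ### The lower bound for the regularisers -/

/-- The index of the layer at time `t ∈ [0,1]`; the time `t = 1` belongs to the last layer. -/
noncomputable def layerIndex (n : ℕ) (t : ℝ) : ℕ := min ⌊(n : ℝ) * t⌋₊ (n - 1)

lemma layerIndex_lt {n : ℕ} (hn : 0 < n) (t : ℝ) : layerIndex n t < n :=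
  (min_le_right _ _).trans_lt (by omega)

lemma layerIndex_mono {n : ℕ} {s t : ℝ} (h : s ≤ t) : layerIndex n s ≤ layerIndex n t :=
  min_le_min_right _ (Nat.floor_mono (by gcongr))

lemma stepExt_eq_layer_layerIndex {V : Type} [AddCommGroup V] {n : ℕ} (hn : 0 < n)
    (a : Fin n → V) {t : ℝ} (ht : t ∈ Ico (0 : ℝ) 1) :
    stepExt a t = layer a (layerIndex n t) := by
  have hn' : (0 : ℝ) < n := by exact_mod_cast hn
  have : ⌊(n : ℝ) * t⌋₊ < n := by
    rw [Nat.floor_lt (mul_nonneg hn'.le ht.1)]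
    have := ht.2
    nlinarith
  rw [stepExt, layerIndex, min_eq_left (by omega)]

lemma tendsto_layerIndex_div {t : ℝ} (ht : t ∈ Icc (0 : ℝ) 1) :
    Tendsto (fun n : ℕ => (layerIndex n t : ℝ) / n) atTop (𝓝 t) := by
  have h1 : Tendsto (fun k : ℕ => ((⌊(k : ℝ) * t⌋₊ : ℝ)) / k) atTop (𝓝 t) := by
    have := (tendsto_nat_floor_mul_div_atTop ht.1).comp tendsto_natCast_atTop_atTop
    simpa [Function.comp_def, mul_comm] using this
  have h2 : Tendsto (fun k : ℕ => 1 - 1 / (k : ℝ)) atTop (𝓝 1) := by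
    simpa using tendsto_const_nhds.sub (tendsto_one_div_atTop_nhds_zero_nat (𝕜 := ℝ))
  have h3 := h1.min h2
  rw [min_eq_left ht.2] at h3
  refine h3.congr' ?_
  filter_upwards [eventually_gt_atTop 0] with k hk
  have hk' : (0 : ℝ) < k := by exact_mod_cast hk
  rw [layerIndex, Nat.cast_min, Nat.cast_sub (by omega), Nat.cast_one, ← min_div_div_right hk'.le]
  congr 1
  field_simp

lemma stepDist_congr {V : Type} [NormedAddCommGroup V] [NormedSpace ℝ V] (N : VNorm V) {n : ℕ}
    (a : Fin n → V) {f g : ℝ → V}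
    (h : f =ᵐ[volume.restrict (Icc (0 : ℝ) 1)] g) : stepDist N a f = stepDist N a g := by
  unfold stepDist
  congr 1
  refine intervalIntegral.integral_congr_ae_restrict ?_
  rw [uIoc_of_le zero_le_one]
  filter_upwards [ae_restrict_of_ae_restrict_of_subset Ioc_subset_Icc_self h] with t ht
  rw [ht]

section

variable {V : Type} [NormedAddCommGroup V] [NormedSpace ℝ V] [FiniteDimensional ℝ V] (N : VNorm V)

lemma MemL2.integrableOn_sq {f : ℝ → V} (hf : MemL2 f) :
    IntegrableOn (fun t => N (f t) ^ 2) (Icc 0 1) := by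
  obtain ⟨c, hc, hN⟩ := N.exists_equiv
  have h := (memLp_two_iff_integrable_sq_norm hf.1).mp hf
  refine (h.const_mul (c ^ 2)).mono' ((N.continuous.pow 2).comp_aestronglyMeasurable hf.1)
    (Eventually.of_forall fun t => ?_)
  rw [Real.norm_of_nonneg (sq_nonneg _), ← mul_pow]
  exact pow_le_pow_left₀ (N.nonneg _) (hN _).1 2

/-- Uniform continuity of `f` on `[0,1]`, measured in the norm `N`. -/
lemma exists_modulus {f : ℝ → V} (hf : ContinuousOn f (Icc 0 1)) {ε : ℝ} (hε : 0 < ε) :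
    ∃ δ > 0, ∀ s ∈ Icc (0 : ℝ) 1, ∀ t ∈ Icc (0 : ℝ) 1, |s - t| ≤ δ → N (f s - f t) ≤ ε := by
  obtain ⟨c, hc, hN⟩ := N.exists_equiv
  obtain ⟨δ, hδ, h⟩ := Metric.uniformContinuousOn_iff.mp
    (isCompact_Icc.uniformContinuousOn_of_continuous hf) (ε / c) (by positivity)
  refine ⟨δ / 2, by positivity, fun s hs t ht hst => ?_⟩
  have := h s hs t ht (by rw [Real.dist_eq]; linarith)
  rw [dist_eq_norm, lt_div_iff₀ hc] at this
  linarith [(hN (f s - f t)).1]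

/-- Along a sequence of bounded energy, convergence in `L²` to a continuous function is uniform:
by the discrete Hölder estimate, a large deviation in one layer forces a large deviation on an
interval of fixed length. -/
lemma eventually_layer_sub_le {l : Filter ℕ} (hl : l ≤ atTop) (a : ∀ n, Fin n → V) {τ C : ℝ}
    (hτ : 0 ≤ τ) (hE : ∀ᶠ n in l, discreteReg N τ (a n) ≤ C) {f : ℝ → V}
    (hf : ContinuousOn f (Icc 0 1)) (hd : Tendsto (fun n => stepDist N (a n) f) l (𝓝 0))
    {ε : ℝ} (hε : 0 < ε) :
    ∀ᶠ n in l, ∀ i < n, N (layer (a n) i - f ((i : ℝ) / n)) ≤ ε := by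
  obtain ⟨δ₀, hδ₀, hmod⟩ := exists_modulus N hf (show 0 < ε / 4 by positivity)
  -- On a time interval of length `δ`, `f` and the layers both vary by at most `ε / 4`.
  obtain ⟨δ, hδ, hδ1, hδ2, hδ3⟩ : ∃ δ : ℝ, 0 < δ ∧ δ ≤ δ₀ ∧ δ ≤ 1 / 2 ∧
      C * (2 * δ) ≤ (ε / 4) ^ 2 := by
    refine ⟨min (min δ₀ (1 / 2)) ((ε / 4) ^ 2 / (2 * (|C| + 1))), by positivity,
      (min_le_left _ _).trans (min_le_left _ _), (min_le_left _ _).trans (min_le_right _ _), ?_⟩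
    have hCp : 0 < |C| + 1 := by positivity
    calc _ ≤ (|C| + 1) * (2 * min (min δ₀ (1 / 2)) ((ε / 4) ^ 2 / (2 * (|C| + 1)))) := by
          gcongr
          linarith [le_abs_self C]
      _ ≤ (|C| + 1) * (2 * ((ε / 4) ^ 2 / (2 * (|C| + 1)))) := by
          gcongr
          exact min_le_right _ _
      _ = (ε / 4) ^ 2 := by field_simp
  have hlarge : ∀ᶠ n : ℕ in l, 1 / (n : ℝ) < δ :=
    ((tendsto_one_div_atTop_nhds_zero_nat (𝕜 := ℝ)).mono_left hl).eventually_lt_const hδ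
  have hsmall : ∀ᶠ n in l, stepDist N (a n) f < √(δ * (ε / 2) ^ 2) :=
    hd.eventually_lt_const (Real.sqrt_pos.mpr (by positivity))
  filter_upwards [hE, hlarge, hsmall] with n hEn hn hdn i hi
  by_contra hcon
  push Not at hcon
  have hn0 : (0 : ℝ) < n := by exact_mod_cast (by omega : 0 < n)
  set x : ℝ := (i : ℝ) / n with hx
  have hx0 : 0 ≤ x := by positivity
  have hx1 : x ≤ 1 := by rw [hx, div_le_one hn0]; exact_mod_cast hi.le
  -- An interval of length `δ` adjacent to `x`, on the side where it stays within `[0,1]`.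
  obtain ⟨p, hp0, hp1, hpx⟩ : ∃ p : ℝ, 0 ≤ p ∧ p + δ ≤ 1 ∧ ∀ t ∈ Ioo p (p + δ), |t - x| ≤ δ := by
    by_cases hxh : x ≤ 1 / 2
    · refine ⟨x, hx0, by linarith, fun t ht => ?_⟩
      rw [abs_le]; constructor <;> linarith [ht.1, ht.2]
    · refine ⟨x - δ, by linarith, by linarith, fun t ht => ?_⟩
      rw [abs_le]; constructor <;> linarith [ht.1, ht.2]
  have hG : IntegrableOn (fun t => N (stepExt (a n) t - f t) ^ 2) (Icc 0 1) :=
    MemL2.integrableOn_sq N ((memL2_stepExt (a n)).sub (MemL2.of_continuousOn hf))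
  have hlow : ∀ t ∈ Ioo p (p + δ), (ε / 2) ^ 2 ≤ N (stepExt (a n) t - f t) ^ 2 := by
    intro t ht
    refine pow_le_pow_left₀ (by positivity) ?_ 2
    have ht0 : 0 ≤ t := by linarith [ht.1]
    have ht1 : t < 1 := by linarith [ht.2]
    have hk : ⌊(n : ℝ) * t⌋₊ < n := by
      rw [Nat.floor_lt (by positivity)]
      nlinarith
    have hk1 := Nat.floor_le (show 0 ≤ (n : ℝ) * t by positivity)
    have hk2 := Nat.lt_floor_add_one ((n : ℝ) * t)
    have h1 : N (layer (a n) i - layer (a n) ⌊(n : ℝ) * t⌋₊) ≤ ε / 4 := by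
      refine (layer_sub_le N (a n) hτ hEn hk hi).trans ?_
      refine Real.sqrt_le_iff.mpr ⟨by positivity, le_trans ?_ hδ3⟩
      have hC : 0 ≤ C := (discreteReg_nonneg N (a n) hτ).trans hEn
      refine mul_le_mul_of_nonneg_left ?_ hC
      have hin : (i : ℝ) = n * x := by rw [hx]; field_simp
      have hd1 : |(i : ℝ) - (⌊(n : ℝ) * t⌋₊ : ℝ)| ≤ n * |t - x| + 1 := by
        have : (i : ℝ) - (⌊(n : ℝ) * t⌋₊ : ℝ) = n * (x - t) + (n * t - ⌊(n : ℝ) * t⌋₊) := by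
          rw [hin]; ring
        rw [this]
        refine (abs_add_le _ _).trans (add_le_add ?_ ?_)
        · rw [abs_mul, abs_of_pos hn0, abs_sub_comm]
        · rw [abs_le]; constructor <;> linarith
      rw [div_le_iff₀ hn0]
      rw [div_lt_iff₀ hn0] at hn
      have := mul_le_mul_of_nonneg_left (hpx t ht) hn0.le
      linarith
    have h2 : N (f t - f x) ≤ ε / 4 :=
      hmod t ⟨ht0, ht1.le⟩ x ⟨hx0, hx1⟩ ((hpx t ht).trans hδ1)
    have h3 : N (layer (a n) i - f x) ≤ N (layer (a n) i - layer (a n) ⌊(n : ℝ) * t⌋₊) +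
        (N (stepExt (a n) t - f t) + N (f t - f x)) := by
      refine le_trans (le_of_eq ?_) ((N.add_le _ _).trans (add_le_add_right (N.add_le _ _) _))
      congr 1
      simp only [stepExt]
      abel
    linarith
  have hint : δ * (ε / 2) ^ 2 ≤ ∫ t in (0 : ℝ)..1, N (stepExt (a n) t - f t) ^ 2 := by
    have hp : p ∈ Icc (0 : ℝ) 1 := ⟨hp0, by linarith⟩
    have hpδ : p + δ ∈ Icc (0 : ℝ) 1 := ⟨by linarith, hp1⟩
    calc δ * (ε / 2) ^ 2 = ∫ t in p..(p + δ), (ε / 2) ^ 2 := by simp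
      _ ≤ ∫ t in p..(p + δ), N (stepExt (a n) t - f t) ^ 2 :=
        intervalIntegral.integral_mono_on_of_le_Ioo (by linarith) intervalIntegrable_const
          (intervalIntegrable_of_integrableOn hG hp hpδ) hlow
      _ ≤ _ := intervalIntegral.integral_mono_interval hp0 (by linarith) hp1
          (Eventually.of_forall fun _ => sq_nonneg _)
          (intervalIntegrable_of_integrableOn hG (by simp) (by simp))
  exact absurd (Real.sqrt_le_sqrt hint) (not_le.mpr hdn)

lemma tendsto_layer_layerIndex {l : Filter ℕ} (hl : l ≤ atTop) (a : ∀ n, Fin n → V) {f : ℝ → V}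
    (hf : ContinuousOn f (Icc 0 1))
    (h : ∀ ε > 0, ∀ᶠ n in l, ∀ i < n, N (layer (a n) i - f ((i : ℝ) / n)) ≤ ε)
    {t : ℝ} (ht : t ∈ Icc (0 : ℝ) 1) :
    Tendsto (fun n => layer (a n) (layerIndex n t)) l (𝓝 (f t)) := by
  have h1 : Tendsto (fun n => layer (a n) (layerIndex n t) - f ((layerIndex n t : ℝ) / n)) l
      (𝓝 0) := by
    rw [← N.tendsto_zero_iff, Metric.tendsto_nhds]
    intro ε hε
    filter_upwards [h (ε / 2) (half_pos hε), hl (eventually_gt_atTop 0)] with n hn hn0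
    rw [Real.dist_0_eq_abs, abs_of_nonneg (N.nonneg _)]
    linarith [hn _ (layerIndex_lt hn0 t)]
  have h2 : Tendsto (fun n : ℕ => f ((layerIndex n t : ℝ) / n)) l (𝓝 (f t)) := by
    refine (hf t ht).tendsto.comp (tendsto_nhdsWithin_iff.mpr
      ⟨(tendsto_layerIndex_div ht).mono_left hl, ?_⟩)
    filter_upwards [hl (eventually_gt_atTop 0)] with n hn0
    have hn0' : (0 : ℝ) < n := by exact_mod_cast hn0
    refine ⟨by positivity, ?_⟩
    rw [div_le_one hn0']
    exact_mod_cast (layerIndex_lt hn0 t).le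
  simpa using h1.add h2

/-- Pointwise limits of families of bounded discrete energy have finite energy. -/
lemma partitionBound_of_tendsto {l : Filter ℕ} [l.NeBot] (hl : l ≤ atTop) (a : ∀ n, Fin n → V)
    {C : ℝ} {f : ℝ → V}
    (hE : ∀ᶠ n in l,
      n * (∑ i ∈ Finset.Ico 1 n, N (layer (a n) i - layer (a n) (i - 1)) ^ 2) ≤ C)
    (h : ∀ t ∈ Icc (0 : ℝ) 1, Tendsto (fun n => layer (a n) (layerIndex n t)) l (𝓝 (f t))) :
    PartitionBound N f C := by
  intro s u v huv hd
  have hlim : Tendsto (fun n : ℕ => ∑ j ∈ s,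
      N (layer (a n) (layerIndex n (v j)) - layer (a n) (layerIndex n (u j))) ^ 2 /
        ((layerIndex n (v j) : ℝ) / n - (layerIndex n (u j) : ℝ) / n)) l
      (𝓝 (∑ j ∈ s, N (f (v j) - f (u j)) ^ 2 / (v j - u j))) := by
    refine tendsto_finsetSum _ (fun j hj => ?_)
    obtain ⟨h1, h2, h3⟩ := huv j hj
    have hu : u j ∈ Icc (0 : ℝ) 1 := ⟨h1, by linarith⟩
    have hv : v j ∈ Icc (0 : ℝ) 1 := ⟨by linarith, h3⟩
    refine Tendsto.div ?_ (((tendsto_layerIndex_div hv).mono_left hl).sub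
      ((tendsto_layerIndex_div hu).mono_left hl)) (by linarith)
    exact ((N.continuous.tendsto _).comp ((h _ hv).sub (h _ hu))).pow 2
  refine le_of_tendsto hlim ?_
  filter_upwards [hE, hl (eventually_gt_atTop 0)] with n hn hn0
  refine le_trans (le_of_eq ?_) ((mul_le_mul_of_nonneg_left
    (sum_sq_sub_div_le N (layer (a n)) n s (fun j => layerIndex n (u j))
      (fun j => layerIndex n (v j)) (fun j hj => ⟨layerIndex_mono (huv j hj).2.1.le,
        layerIndex_lt hn0 _⟩) (fun i hi j hj hij => ?_)) (Nat.cast_nonneg n)).trans hn)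
  · rw [Finset.mul_sum]
    refine Finset.sum_congr rfl (fun j _ => ?_)
    rw [← sub_div, div_div_eq_mul_div]
    ring
  · rcases hd i hi j hj hij with h1 | h1
    · exact Or.inl (layerIndex_mono h1)
    · exact Or.inr (layerIndex_mono h1)

/-- The liminf inequality for one regulariser, along an arbitrary filter. -/
lemma eventually_continuumReg_le {l : Filter ℕ} (hl : l ≤ atTop) (a : ∀ n, Fin n → V)
    {τ : ℝ} {f : ℝ → V} (hf : MemH1 f)
    (h : ∀ ε > 0, ∀ᶠ n in l, ∀ i < n, N (layer (a n) i - contRep f ((i : ℝ) / n)) ≤ ε)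
    {ε : ℝ} (hε : 0 < ε) :
    ∀ᶠ n in l, continuumReg N τ f ≤ discreteReg N τ (a n) + ε := by
  have hc := hf.contRep_spec.1
  have hderiv : ∀ᶠ n in l, ∫ t in (0 : ℝ)..1, N (weakDeriv f t) ^ 2 ≤
      n * (∑ i ∈ Finset.Ico 1 n, N (layer (a n) i - layer (a n) (i - 1)) ^ 2) + ε / 2 := by
    by_contra hcon
    rw [not_eventually] at hcon
    -- Restrict to the indices at which the inequality fails; there the energies are too small.
    set l' := l ⊓ 𝓟 {n | ¬ (∫ t in (0 : ℝ)..1, N (weakDeriv f t) ^ 2 ≤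
      n * (∑ i ∈ Finset.Ico 1 n, N (layer (a n) i - layer (a n) (i - 1)) ^ 2) + ε / 2)} with hl'
    have hne : l'.NeBot := frequently_mem_iff_neBot.mp hcon
    have hle : l' ≤ l := inf_le_left
    have hpb := partitionBound_of_tendsto N (hle.trans hl) a (f := contRep f)
      (C := (∫ t in (0 : ℝ)..1, N (weakDeriv f t) ^ 2) - ε / 2)
      (by
        filter_upwards [mem_inf_of_right (mem_principal_self _)] with n hn
        simp only [not_le] at hn
        linarith)
      (fun t ht => tendsto_layer_layerIndex N (hle.trans hl) a hc
        (fun ε hε => hle (h ε hε)) ht)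
    obtain ⟨g, hg, hfg, hgC⟩ := hpb.exists_eq_primitive
    have e : ∫ t in (0 : ℝ)..1, N (weakDeriv f t) ^ 2 = ∫ t in (0 : ℝ)..1, N (g t) ^ 2 := by
      refine intervalIntegral.integral_congr_ae_restrict ?_
      rw [uIoc_of_le zero_le_one]
      filter_upwards [ae_restrict_of_ae_restrict_of_subset Ioc_subset_Icc_self
        (hf.weakDeriv_ae_eq hg hfg)] with t ht
      rw [ht]
    linarith
  have h0 : Tendsto (fun n => τ * N (layer (a n) 0) ^ 2) l (𝓝 (τ * N (contRep f 0) ^ 2)) := by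
    have := tendsto_layer_layerIndex N hl a hc h (t := 0) (by simp)
    simp only [layerIndex, mul_zero, Nat.floor_zero, Nat.zero_min] at this
    exact (((N.continuous.tendsto _).comp this).pow 2).const_mul τ
  filter_upwards [hderiv, h0.eventually_const_lt (show τ * N (contRep f 0) ^ 2 - ε / 2 <
    τ * N (contRep f 0) ^ 2 by linarith)] with n h1 h2
  unfold continuumReg discreteReg
  linarith

end

/-! ### Compactness and recovery sequences for the regularisers -/

/-- Sampling the continuous representative of an `H¹` function at the points `i / n`. -/
noncomputable def sample {V : Type} [NormedAddCommGroup V] (f : ℝ → V) (n : ℕ) :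
    Fin n → V := fun i => contRep f ((i : ℝ) / n)

lemma layer_sample {V : Type} [NormedAddCommGroup V] (f : ℝ → V) {n i : ℕ} (hi : i < n) :
    layer (sample f n) i = contRep f ((i : ℝ) / n) := by
  simp only [layer, dif_pos hi, sample]

section

variable {V : Type} [NormedAddCommGroup V] [NormedSpace ℝ V] [FiniteDimensional ℝ V] (N : VNorm V)

/-- Bounded pointwise convergence of step functions implies convergence in the `L²` distance. -/
lemma tendsto_stepDist {m : ℕ → ℕ} (a : ∀ n, Fin n → V) {f : ℝ → V} (hf : MemL2 f) {R R' : ℝ}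
    (ha : ∀ k i, N (layer (a (m k)) i) ≤ R) (hfR : ∀ t ∈ Icc (0 : ℝ) 1, N (f t) ≤ R')
    (h : ∀ t ∈ Ico (0 : ℝ) 1, Tendsto (fun k => stepExt (a (m k)) t) atTop (𝓝 (f t))) :
    Tendsto (fun k => stepDist N (a (m k)) f) atTop (𝓝 0) := by
  have key : Tendsto (fun k => ∫ t in (0 : ℝ)..1, N (stepExt (a (m k)) t - f t) ^ 2) atTop
      (𝓝 (∫ _ in (0 : ℝ)..1, (0 : ℝ))) := by
    refine intervalIntegral.tendsto_integral_filter_of_dominated_convergence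
      (fun _ => (R + R') ^ 2) (Eventually.of_forall fun k => ?_)
      (Eventually.of_forall fun k => Eventually.of_forall fun t ht => ?_)
      intervalIntegrable_const ?_
    · rw [uIoc_of_le zero_le_one]
      exact ((MemL2.integrableOn_sq N ((memL2_stepExt (a (m k))).sub hf)).mono_set
        Ioc_subset_Icc_self).aestronglyMeasurable
    · rw [uIoc_of_le zero_le_one] at ht
      rw [Real.norm_of_nonneg (sq_nonneg _)]
      refine pow_le_pow_left₀ (N.nonneg _) ?_ 2
      rw [sub_eq_add_neg]
      refine (N.add_le _ _).trans (add_le_add (ha k _) ?_)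
      rw [← zero_sub, N.sub_comm, sub_zero]
      exact hfR t (Ioc_subset_Icc_self ht)
    -- At `t = 1` the step extension has the junk value `0`.
    · have h1 : ∀ᵐ t : ℝ, t ≠ 1 := by simp [ae_iff]
      filter_upwards [h1] with t ht1 ht
      rw [uIoc_of_le zero_le_one] at ht
      have := (h t ⟨ht.1.le, lt_of_le_of_ne ht.2 ht1⟩).sub_const (f t)
      rw [sub_self] at this
      simpa using (N.tendsto_zero_iff.mpr this).pow 2
  rw [intervalIntegral.integral_zero] at key
  have := (Real.continuous_sqrt.tendsto 0).comp key
  simpa [stepDist, Function.comp_def] using this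

/-- Families of bounded discrete energy have a subsequence that converges at every time, to a
limit in `H¹`. A diagonal argument gives convergence at rational times, and the discrete Hölder
estimate extends it to all times. -/
theorem exists_subseq_tendsto_stepDist (a : ∀ n, Fin n → V) {τ C : ℝ} (hτ : 0 < τ)
    (hE : ∀ n : ℕ, 1 ≤ n → discreteReg N τ (a n) ≤ C) {φ : ℕ → ℕ} (hφ : StrictMono φ) :
    ∃ ψ : ℕ → ℕ, StrictMono ψ ∧ ∃ f : ℝ → V, MemH1 f ∧
      Tendsto (fun k => stepDist N (a (φ (ψ k))) f) atTop (𝓝 0) := by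
  have : ProperSpace V := FiniteDimensional.proper ℝ V
  obtain ⟨c, hc, hN⟩ := N.exists_equiv
  have hC : 0 ≤ C := (discreteReg_nonneg N (a 1) hτ.le).trans (hE 1 le_rfl)
  set R := √C + √(C / τ) with hR
  have hbd : ∀ n i, N (layer (a n) i) ≤ R := fun n i => by
    rcases Nat.eq_zero_or_pos n with rfl | hn
    · simp only [layer, Nat.not_lt_zero, dite_false, N.map_zero]
      positivity
    · exact layer_le N (a n) hτ (hE n hn) i
  -- The value at time `t` of the network of depth `n`.
  let w : ℕ → ℝ → V := fun n t => layer (a n) (layerIndex n t)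
  obtain ⟨g, -, ψ, hψ, hg⟩ := (isCompact_univ_pi
    (fun _ : ℚ => isCompact_closedBall (0 : V) (c * R))).tendsto_subseq
    (x := fun k => fun r : ℚ => w (φ k) r) (fun k r _ => by
      rw [mem_closedBall_zero_iff]
      refine (hN _).2.trans ?_
      gcongr
      exact hbd _ _)
  rw [tendsto_pi_nhds] at hg
  have hφψ : Tendsto (fun k => φ (ψ k)) atTop atTop := (hφ.comp hψ).tendsto_atTop
  -- Times at distance at most `δ` have asymptotically close values.
  have hequi : ∀ ε > 0, ∃ δ > 0, ∀ s ∈ Icc (0 : ℝ) 1, ∀ t ∈ Icc (0 : ℝ) 1, |s - t| < δ →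
      ∀ᶠ k in atTop, N (w (φ (ψ k)) s - w (φ (ψ k)) t) < ε := by
    intro ε hε
    refine ⟨ε ^ 2 / (C + 1), by positivity, fun s hs t ht hst => ?_⟩
    have h1 : Tendsto (fun n : ℕ => √(C * (|(layerIndex n s : ℝ) - layerIndex n t| / n))) atTop
        (𝓝 √(C * |s - t|)) := by
      have := ((tendsto_layerIndex_div hs).sub (tendsto_layerIndex_div ht)).abs
      refine (Real.continuous_sqrt.tendsto _).comp ((this.congr (fun n => ?_)).const_mul C)
      rw [← sub_div, abs_div, Nat.abs_cast]
    have h2 : √(C * |s - t|) < ε := by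
      rw [Real.sqrt_lt' hε]
      calc C * |s - t| ≤ (C + 1) * |s - t| := by gcongr; linarith
        _ < (C + 1) * (ε ^ 2 / (C + 1)) := by gcongr
        _ = ε ^ 2 := by field_simp
    filter_upwards [(h1.comp hφψ).eventually_lt_const h2,
      hφψ.eventually (eventually_gt_atTop 0)] with k hk hk0
    exact (layer_sub_le N (a (φ (ψ k))) hτ.le (hE _ hk0) (layerIndex_lt hk0 t)
      (layerIndex_lt hk0 s)).trans_lt hk
  have hlim : ∀ t ∈ Icc (0 : ℝ) 1, ∃ y, Tendsto (fun k => w (φ (ψ k)) t) atTop (𝓝 y) := by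
    intro t ht
    refine cauchySeq_tendsto_of_complete (Metric.cauchySeq_iff.mpr fun ε hε => ?_)
    obtain ⟨δ, hδ, hclose⟩ := hequi (ε / (4 * c)) (by positivity)
    obtain ⟨r, hr, hrt⟩ : ∃ r : ℚ, (r : ℝ) ∈ Icc (0 : ℝ) 1 ∧ |t - r| < δ := by
      rcases lt_or_ge t 1 with h1 | h1
      · obtain ⟨r, hr1, hr2⟩ := exists_rat_btwn (show t < min 1 (t + δ) by
          rw [lt_min_iff]; constructor <;> linarith)
        rw [lt_min_iff] at hr2
        refine ⟨r, ⟨by linarith [ht.1], hr2.1.le⟩, ?_⟩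
        rw [abs_lt]; constructor <;> linarith [hr2.2]
      · refine ⟨1, by simp, ?_⟩
        rw [show t = 1 from le_antisymm ht.2 h1]
        simpa using hδ
    obtain ⟨K, hK⟩ := Metric.cauchySeq_iff.mp ((hg r).cauchySeq) (ε / 2) (by positivity)
    obtain ⟨K', hK'⟩ := eventually_atTop.mp (hclose t ht r hr hrt)
    have hcl : ∀ k ≥ K', ‖w (φ (ψ k)) t - w (φ (ψ k)) r‖ < ε / 4 := fun k hk => by
      refine (hN _).2.trans_lt ?_
      calc _ < c * (ε / (4 * c)) := by gcongr; exact hK' k hk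
        _ = ε / 4 := by field_simp
    refine ⟨max K K', fun i hi j hj => ?_⟩
    have h1 := hcl i ((le_max_right _ _).trans hi)
    have h2 := hcl j ((le_max_right _ _).trans hj)
    have h3 := hK i ((le_max_left _ _).trans hi) j ((le_max_left _ _).trans hj)
    simp only [Function.comp_apply, dist_eq_norm] at h3
    rw [dist_eq_norm]
    have e : w (φ (ψ i)) t - w (φ (ψ j)) t = (w (φ (ψ i)) t - w (φ (ψ i)) r) +
        (w (φ (ψ i)) r - w (φ (ψ j)) r) - (w (φ (ψ j)) t - w (φ (ψ j)) r) := by abel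
    rw [e]
    linarith [norm_sub_le ((w (φ (ψ i)) t - w (φ (ψ i)) r) +
      (w (φ (ψ i)) r - w (φ (ψ j)) r)) (w (φ (ψ j)) t - w (φ (ψ j)) r),
      norm_add_le (w (φ (ψ i)) t - w (φ (ψ i)) r) (w (φ (ψ i)) r - w (φ (ψ j)) r)]
  choose! f hf using hlim
  have hpb : PartitionBound N f C := by
    refine partitionBound_of_tendsto (l := map (fun k => φ (ψ k)) atTop) N hφψ a ?_
      (fun t ht => tendsto_map'_iff.mpr (hf t ht))
    filter_upwards [hφψ (eventually_gt_atTop 0)] with n hn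
    exact incr_energy_le N (a n) hτ.le (hE n hn)
  obtain ⟨f', hf', hff', -⟩ := hpb.exists_eq_primitive
  have hH1 := memH1_of_eq_primitive hf' hff'
  refine ⟨ψ, hψ, f, hH1, tendsto_stepDist N (m := fun k => φ (ψ k)) a hH1.1 (R := R) (R' := R)
    (fun k i => hbd _ i) (fun t ht => ?_) (fun t ht => ?_)⟩
  · exact le_of_tendsto ((N.continuous.tendsto _).comp (hf t ht))
      (Eventually.of_forall fun k => hbd _ _)
  · refine (hf t (Ico_subset_Icc_self ht)).congr' ?_
    filter_upwards [hφψ.eventually (eventually_gt_atTop 0)] with k hk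
    exact (stepExt_eq_layer_layerIndex hk _ ht).symm

lemma tendsto_stepDist_sample {f : ℝ → V} (hf : MemH1 f) :
    Tendsto (fun n => stepDist N (sample f n) f) atTop (𝓝 0) := by
  obtain ⟨c, hc, hN⟩ := N.exists_equiv
  have hfc := hf.contRep_spec.1
  obtain ⟨B, hB⟩ := isCompact_Icc.exists_bound_of_continuousOn hfc
  have hB0 : 0 ≤ B := (norm_nonneg _).trans (hB 0 (by simp))
  simp only [stepDist_congr N (sample f _) hf.contRep_spec.2]
  have hb : ∀ t ∈ Icc (0 : ℝ) 1, N (contRep f t) ≤ c * B := fun t ht =>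
    (hN _).1.trans (by gcongr; exact hB t ht)
  refine tendsto_stepDist N (m := id) (sample f) (MemL2.of_continuousOn hfc) (R := c * B)
    (fun n i => ?_) hb (fun t ht => ?_)
  · by_cases hi : i < n
    · rw [id, layer_sample f hi]
      have hn : (0 : ℝ) < n := by exact_mod_cast (by omega : 0 < n)
      exact hb _ ⟨by positivity, by rw [div_le_one hn]; exact_mod_cast hi.le⟩
    · simp only [id, layer, dif_neg hi, N.map_zero]
      positivity
  · refine (tendsto_layer_layerIndex N le_rfl (sample f) hfc (fun ε hε =>
      Eventually.of_forall fun n i hi => ?_) (Ico_subset_Icc_self ht)).congr' ?_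
    · rw [layer_sample f hi, sub_self, N.map_zero]
      exact hε.le
    · filter_upwards [eventually_gt_atTop 0] with n hn
      exact (stepExt_eq_layer_layerIndex hn _ ht).symm

/-- Jensen's inequality for the increment of a primitive. -/
lemma sq_integral_le {g : ℝ → V} (hg : MemL2 g) {s t : ℝ} (hs : 0 ≤ s) (hst : s < t) (ht : t ≤ 1) :
    N (∫ r in s..t, g r) ^ 2 ≤ (t - s) * ∫ r in s..t, N (g r) ^ 2 := by
  have hconv : ConvexOn ℝ univ (fun v : V => N v ^ 2) :=
    N.toSeminorm.convexOn.pow (fun v _ => N.nonneg v) 2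
  have hsub : Ioc s t ⊆ Icc 0 1 := fun r hr => ⟨by linarith [hr.1], by linarith [hr.2]⟩
  have hJ := hconv.map_set_average_le (μ := volume) (t := Ioc s t) (f := g)
    (N.continuous.pow 2).continuousOn isClosed_univ (by simp [hst]) (by simp)
    (Eventually.of_forall fun _ => mem_univ _) (hg.integrableOn.mono_set hsub)
    ((MemL2.integrableOn_sq N hg).mono_set hsub)
  rw [setAverage_eq, setAverage_eq] at hJ
  have hv : volume.real (Ioc s t) = t - s := by
    rw [Measure.real, Real.volume_Ioc, ENNReal.toReal_ofReal (by linarith)]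
  have hpos : 0 < t - s := by linarith
  rw [hv, ← intervalIntegral.integral_of_le hst.le, N.smul, abs_of_pos (inv_pos.mpr hpos)] at hJ
  simp only [smul_eq_mul] at hJ
  rw [← intervalIntegral.integral_of_le hst.le] at hJ
  calc N (∫ r in s..t, g r) ^ 2
      = (t - s) ^ 2 * ((t - s)⁻¹ * N (∫ r in s..t, g r)) ^ 2 := by field_simp
    _ ≤ (t - s) ^ 2 * ((t - s)⁻¹ * ∫ r in s..t, N (g r) ^ 2) := by gcongr
    _ = _ := by field_simp

lemma discreteReg_sample_le {τ : ℝ} {f : ℝ → V} (hf : MemH1 f) {n : ℕ} (hn : 0 < n) :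
    discreteReg N τ (sample f n) ≤ continuumReg N τ f := by
  have hn' : (0 : ℝ) < n := by exact_mod_cast hn
  have hg := hf.weakDeriv_spec.1
  have hgi := MemL2.integrableOn_sq N hg
  have hmem : ∀ k ≤ n, (k : ℝ) / n ∈ Icc (0 : ℝ) 1 := fun k hk =>
    ⟨by positivity, by rw [div_le_one hn']; exact_mod_cast hk⟩
  unfold discreteReg continuumReg
  rw [layer_sample f hn, Nat.cast_zero, zero_div]
  gcongr
  rw [Finset.sum_Ico_eq_sum_range, Finset.mul_sum]
  calc ∑ k ∈ Finset.range (n - 1),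
        n * N (layer (sample f n) (1 + k) - layer (sample f n) (1 + k - 1)) ^ 2
      ≤ ∑ k ∈ Finset.range (n - 1),
        ∫ t in (k : ℝ) / n..((k + 1 : ℕ) : ℝ) / n, N (weakDeriv f t) ^ 2 := by
        refine Finset.sum_le_sum (fun k hk => ?_)
        rw [Finset.mem_range] at hk
        have h0 : (0 : ℝ) ∈ Icc (0 : ℝ) 1 := by simp
        have hk0 := hmem k (by omega)
        have hk1 := hmem (k + 1) (by omega)
        have hlt : (k : ℝ) / n < ((k + 1 : ℕ) : ℝ) / n := by gcongr; simp
        rw [layer_sample f (by omega), layer_sample f (by omega), Nat.add_sub_cancel_left,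
          add_comm 1 k, hf.contRep_eq_primitive _ hk0, hf.contRep_eq_primitive _ hk1,
          add_sub_add_left_eq_sub, intervalIntegral.integral_interval_sub_left
            (intervalIntegrable_of_integrableOn hg.integrableOn h0 hk1)
            (intervalIntegrable_of_integrableOn hg.integrableOn h0 hk0)]
        have := sq_integral_le N hg hk0.1 hlt hk1.2
        have e : ((k + 1 : ℕ) : ℝ) / n - (k : ℝ) / n = 1 / n := by push_cast; ring
        rw [e] at this
        calc _ ≤ (n : ℝ) * (1 / n * _) := mul_le_mul_of_nonneg_left this hn'.le
          _ = _ := by field_simp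
    _ = ∫ t in (0 : ℝ)..((n - 1 : ℕ) : ℝ) / n, N (weakDeriv f t) ^ 2 := by
        have := intervalIntegral.sum_integral_adjacent_intervals (μ := volume)
          (f := fun t => N (weakDeriv f t) ^ 2) (a := fun k : ℕ => (k : ℝ) / n) (n := n - 1)
          (fun k hk => intervalIntegrable_of_integrableOn hgi (hmem k (by omega))
            (hmem (k + 1) (by omega)))
        simpa using this
    _ ≤ ∫ t in (0 : ℝ)..1, N (weakDeriv f t) ^ 2 :=
        intervalIntegral.integral_mono_interval le_rfl (by positivity) (hmem (n - 1) (by omega)).2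
          (Eventually.of_forall fun _ => sq_nonneg _)
          (intervalIntegrable_of_integrableOn hgi (by simp) (by simp))

end

/-! ### The limiting differential equation and its Euler scheme -/

lemma norm_mulVec_le {m d : ℕ} (A : Matrix (Fin m) (Fin d) ℝ) (v : Fin d → ℝ) :
    ‖A *ᵥ v‖ ≤ d * (‖A‖ * ‖v‖) := by
  rw [pi_norm_le_iff_of_nonneg (by positivity)]
  intro i
  calc ‖(A *ᵥ v) i‖ ≤ ∑ j, ‖A i j * v j‖ := norm_sum_le Finset.univ fun j => A i j * v j
    _ ≤ ∑ _j : Fin d, ‖A‖ * ‖v‖ := by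
        refine Finset.sum_le_sum fun j _ => ?_
        rw [norm_mul]
        exact mul_le_mul (A.norm_entry_le_entrywise_sup_norm) (norm_le_pi_norm v j)
          (norm_nonneg _) (norm_nonneg _)
    _ = d * (‖A‖ * ‖v‖) := by simp

lemma continuous_mulVec {m d : ℕ} :
    Continuous fun p : Matrix (Fin m) (Fin d) ℝ × (Fin d → ℝ) => p.1 *ᵥ p.2 :=
  Continuous.matrix_mulVec continuous_fst continuous_snd

/-- Entrywise truncation to `[-R, R]`: the nearest-point projection onto the ball of radius `R` in
the supremum norm. -/
def clamp {d : ℕ} (R : ℝ) (v : Fin d → ℝ) : Fin d → ℝ := fun i => max (-R) (min R (v i))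

lemma norm_clamp_sub_le {d : ℕ} (R : ℝ) (v w : Fin d → ℝ) : ‖clamp R v - clamp R w‖ ≤ ‖v - w‖ := by
  rw [pi_norm_le_iff_of_nonneg (norm_nonneg _)]
  intro i
  refine le_trans ?_ (norm_le_pi_norm (v - w) i)
  simp only [clamp, Pi.sub_apply, Real.norm_eq_abs]
  refine (abs_max_sub_max_le_max _ _ _ _).trans ?_
  rw [sub_self, abs_zero, max_eq_right (abs_nonneg _)]
  refine (abs_min_sub_min_le_max _ _ _ _).trans ?_
  rw [sub_self, abs_zero, max_eq_right (abs_nonneg _)]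

lemma norm_clamp_le {d : ℕ} {R : ℝ} (hR : 0 ≤ R) (v : Fin d → ℝ) : ‖clamp R v‖ ≤ R := by
  rw [pi_norm_le_iff_of_nonneg hR]
  intro i
  rw [Real.norm_eq_abs, abs_le]
  exact ⟨le_max_left _ _, max_le (by linarith) (min_le_left _ _)⟩

lemma clamp_eq_self {d : ℕ} {R : ℝ} {v : Fin d → ℝ} (h : ‖v‖ ≤ R) : clamp R v = v := by
  funext i
  have := (norm_le_pi_norm v i).trans h
  rw [Real.norm_eq_abs, abs_le] at this
  rw [clamp, min_eq_right this.2, max_eq_right this.1]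

lemma norm_clamp_le_norm {d : ℕ} {R : ℝ} (hR : 0 ≤ R) (v : Fin d → ℝ) : ‖clamp R v‖ ≤ ‖v‖ := by
  have h0 : clamp R (0 : Fin d → ℝ) = 0 := clamp_eq_self (by simpa using hR)
  simpa [h0] using norm_clamp_sub_le R v 0

section ODE

variable {d : ℕ} {σ : (Fin d → ℝ) → (Fin d → ℝ)} {L : NNReal}
  {A : ℝ → Matrix (Fin d) (Fin d) ℝ} {β : ℝ → Fin d → ℝ}

lemma norm_sigma_le (hσ : LipschitzWith L σ) (hσ0 : σ 0 = 0) (v : Fin d → ℝ) :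
    ‖σ v‖ ≤ L * ‖v‖ := by
  have := hσ.dist_le_mul v 0
  rwa [hσ0, dist_zero_right, dist_zero_right] at this

/-- Global existence. The field is truncated outside a large ball so that a single application of
the Picard-Lindelöf theorem covers the whole of `[0,1]`; by Grönwall's inequality the solution of
the truncated equation never leaves the ball. -/
theorem exists_solution (hσ : LipschitzWith L σ) (hσ0 : σ 0 = 0) (hA : ContinuousOn A (Icc 0 1))
    (hβ : ContinuousOn β (Icc 0 1)) (x₀ : Fin d → ℝ) :
    ∃ X : ℝ → Fin d → ℝ, X 0 = x₀ ∧ ∀ t ∈ Icc (0 : ℝ) 1,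
      HasDerivWithinAt X (σ (A t *ᵥ X t + β t)) (Icc 0 1) t := by
  obtain ⟨k, hk⟩ := isCompact_Icc.exists_bound_of_continuousOn hA
  obtain ⟨B, hB⟩ := isCompact_Icc.exists_bound_of_continuousOn hβ
  have h01 : (0 : ℝ) ∈ Icc (0 : ℝ) 1 := by simp
  have hk0 : 0 ≤ k := (norm_nonneg _).trans (hk 0 h01)
  have hB0 : 0 ≤ B := (norm_nonneg _).trans (hB 0 h01)
  have hL0 : (0 : ℝ) ≤ L := L.2
  set κ : ℝ := L * (d * k) with hκ
  have hκ0 : 0 ≤ κ := by positivity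
  set R : ℝ := gronwallBound ‖x₀‖ κ (L * B) 1 with hR
  have hmono := gronwallBound_mono (norm_nonneg x₀) (by positivity : 0 ≤ L * B) hκ0
  have hR0 : 0 ≤ R := by
    have := hmono (zero_le_one (α := ℝ))
    rw [gronwallBound_x0] at this
    exact (norm_nonneg _).trans this
  have hgrow : ∀ t ∈ Icc (0 : ℝ) 1, ∀ x : Fin d → ℝ,
      ‖σ (A t *ᵥ x + β t)‖ ≤ κ * ‖x‖ + L * B := by
    intro t ht x
    calc ‖σ (A t *ᵥ x + β t)‖ ≤ L * ‖A t *ᵥ x + β t‖ := norm_sigma_le hσ hσ0 _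
      _ ≤ L * (d * (k * ‖x‖) + B) := by
          gcongr
          refine (norm_add_le _ _).trans (add_le_add ((norm_mulVec_le _ _).trans ?_) (hB t ht))
          gcongr
          exact hk t ht
      _ = κ * ‖x‖ + L * B := by rw [hκ]; ring
  let F : ℝ → (Fin d → ℝ) → (Fin d → ℝ) := fun t x => σ (A t *ᵥ clamp R x + β t)
  let M : NNReal := ⟨κ * R + L * B, by positivity⟩
  have hPL : IsPicardLindelof F (⟨0, h01⟩ : Icc (0 : ℝ) 1) x₀ M 0 M ⟨κ, hκ0⟩ := by
    refine ⟨fun t ht => ?_, fun x _ => ?_, fun t ht x _ => ?_, ?_⟩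
    · refine (LipschitzWith.of_dist_le_mul fun x y => ?_).lipschitzOnWith
      calc dist (F t x) (F t y)
          ≤ L * dist (A t *ᵥ clamp R x + β t) (A t *ᵥ clamp R y + β t) := hσ.dist_le_mul _ _
        _ = L * ‖A t *ᵥ (clamp R x - clamp R y)‖ := by
            rw [dist_add_right, dist_eq_norm, Matrix.mulVec_sub]
        _ ≤ L * (d * (k * ‖x - y‖)) := by
            gcongr
            refine (norm_mulVec_le _ _).trans ?_
            gcongr
            · exact hk t ht
            · exact norm_clamp_sub_le R x y
        _ = κ * dist x y := by rw [hκ, dist_eq_norm]; ring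
    · exact hσ.continuous.comp_continuousOn
        ((continuous_mulVec.comp_continuousOn (hA.prodMk continuousOn_const)).add hβ)
    · refine (hgrow t ht _).trans ?_
      change κ * ‖clamp R x‖ + L * B ≤ κ * R + L * B
      gcongr
      exact norm_clamp_le hR0 x
    · simp
  obtain ⟨X, hX0, hX⟩ := hPL.exists_eq_forall_mem_Icc_hasDerivWithinAt₀
  change X 0 = x₀ at hX0
  have hXR : ∀ t ∈ Icc (0 : ℝ) 1, ‖X t‖ ≤ R := by
    intro t ht
    have := norm_le_gronwallBound_of_norm_deriv_right_le (f := X) (f' := fun t => F t (X t))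
      (δ := ‖x₀‖) (K := κ) (ε := L * B) (a := 0) (b := 1)
      (fun t ht => (hX t ht).continuousWithinAt)
      (fun t ht => (hX t (Ico_subset_Icc_self ht)).mono_of_mem_nhdsWithin
        (mem_of_superset (Icc_mem_nhdsGE ht.2) (Icc_subset_Icc_left ht.1))) (by rw [hX0])
      (fun t ht => (hgrow t (Ico_subset_Icc_self ht) _).trans (by
        gcongr
        exact norm_clamp_le_norm hR0 _)) t ht
    rw [sub_zero] at this
    exact this.trans (hmono ht.2)
  refine ⟨X, hX0, fun t ht => ?_⟩
  have := hX t ht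
  simp only [F, clamp_eq_self (hXR t ht)] at this
  exact this

lemma odeSolution_spec (hσ : LipschitzWith L σ) (hσ0 : σ 0 = 0)
    {K : ℝ → Matrix (Fin d) (Fin d) ℝ} {b : ℝ → Fin d → ℝ} (hK : MemH1 K) (hb : MemH1 b)
    (x₀ : Fin d → ℝ) : IsODESolution σ K b x₀ (odeSolution σ K b x₀) := by
  have h : ∃ X, IsODESolution σ K b x₀ X :=
    exists_solution hσ hσ0 hK.contRep_spec.1 hb.contRep_spec.1 x₀
  simp only [odeSolution, dif_pos h]
  exact h.choose_spec

/-- The Euler scheme, whose coefficients are uniformly close to those of the equation, converges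
to every solution of the equation. -/
theorem tendsto_forward (hσ : LipschitzWith L σ) (hA : ContinuousOn A (Icc 0 1))
    (hβ : ContinuousOn β (Icc 0 1)) {X : ℝ → Fin d → ℝ}
    (hX : ∀ t ∈ Icc (0 : ℝ) 1, HasDerivWithinAt X (σ (A t *ᵥ X t + β t)) (Icc 0 1) t)
    {l : Filter ℕ} (hl : l ≤ atTop) {K : ∀ n, Fin n → Matrix (Fin d) (Fin d) ℝ}
    {b : ∀ n, Fin n → Fin d → ℝ}
    (hK : ∀ ε > 0, ∀ᶠ n in l, ∀ i < n, ‖layer (K n) i - A ((i : ℝ) / n)‖ ≤ ε)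
    (hb : ∀ ε > 0, ∀ᶠ n in l, ∀ i < n, ‖layer (b n) i - β ((i : ℝ) / n)‖ ≤ ε) :
    Tendsto (fun n => forward σ (K n) (b n) (X 0) n) l (𝓝 (X 1)) := by
  have h01 : (0 : ℝ) ∈ Icc (0 : ℝ) 1 := by simp
  have hL0 : (0 : ℝ) ≤ L := L.2
  have hXc : ContinuousOn X (Icc 0 1) := fun t ht => (hX t ht).continuousWithinAt
  obtain ⟨k, hk⟩ := isCompact_Icc.exists_bound_of_continuousOn hA
  obtain ⟨ρ, hρ⟩ := isCompact_Icc.exists_bound_of_continuousOn hXc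
  have hk0 : 0 ≤ k := (norm_nonneg _).trans (hk 0 h01)
  have hρ0 : 0 ≤ ρ := (norm_nonneg _).trans (hρ 0 h01)
  set F : ℝ → Fin d → ℝ := fun t => A t *ᵥ X t + β t with hF
  have hFc : ContinuousOn F (Icc 0 1) :=
    (continuous_mulVec.comp_continuousOn (hA.prodMk hXc)).add hβ
  set κ : ℝ := L * (d * (k + 1)) with hκ
  have hκ0 : 0 ≤ κ := by positivity
  rw [Metric.tendsto_nhds]
  intro ε hε
  -- The consistency error `L * η` per unit of time is amplified by a factor of at most `exp κ`.
  set η : ℝ := ε / (2 * ((L + 1) * Real.exp κ)) with hη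
  have hη0 : 0 < η := by positivity
  obtain ⟨δ, hδ0, hδ⟩ := Metric.uniformContinuousOn_iff.mp
    (isCompact_Icc.uniformContinuousOn_of_continuous hFc) (η / 3) (by positivity)
  have hlarge : ∀ᶠ n : ℕ in l, 1 / (n : ℝ) < δ :=
    ((tendsto_one_div_atTop_nhds_zero_nat (𝕜 := ℝ)).mono_left hl).eventually_lt_const hδ0
  filter_upwards [hlarge, hl (eventually_gt_atTop 0), hK 1 one_pos,
    hK (η / (3 * (d * ρ + 1))) (by positivity), hb (η / 3) (by positivity)]
    with n hnδ hn hK1 hKη hbη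
  have hn' : (0 : ℝ) < n := by exact_mod_cast hn
  have hmem : ∀ i ≤ n, (i : ℝ) / n ∈ Icc (0 : ℝ) 1 := fun i hi =>
    ⟨by positivity, by rw [div_le_one hn']; exact_mod_cast hi⟩
  -- The consistency error of one step.
  have hcons : ∀ i < n, ‖X (((i + 1 : ℕ) : ℝ) / n) - X ((i : ℝ) / n) -
      (1 / (n : ℝ)) • σ (layer (K n) i *ᵥ X ((i : ℝ) / n) + layer (b n) i)‖ ≤ L * η * (1 / n) := by
    intro i hi
    have hi0 := hmem i hi.le
    have hi1 := hmem (i + 1) hi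
    set s : ℝ := (i : ℝ) / n with hs
    set t : ℝ := ((i + 1 : ℕ) : ℝ) / n with ht
    have hst : t - s = 1 / n := by rw [hs, ht]; push_cast; ring
    have hst' : s ≤ t := by have : (0 : ℝ) < 1 / n := by positivity
                            linarith
    set v := layer (K n) i *ᵥ X s + layer (b n) i with hv
    have hsub : Icc s t ⊆ Icc (0 : ℝ) 1 := Icc_subset_Icc hi0.1 hi1.2
    have hFv : ‖F s - v‖ ≤ η / 3 + η / 3 := by
      have e : F s - v = -((layer (K n) i - A s) *ᵥ X s + (layer (b n) i - β s)) := by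
        rw [hF, hv, Matrix.sub_mulVec]
        simp only
        abel
      rw [e, norm_neg]
      refine (norm_add_le _ _).trans (add_le_add ?_ (hbη i hi))
      calc ‖(layer (K n) i - A s) *ᵥ X s‖ ≤ d * (‖layer (K n) i - A s‖ * ‖X s‖) :=
            norm_mulVec_le _ _
        _ ≤ d * (η / (3 * (d * ρ + 1)) * ρ) := by
            gcongr
            · exact hKη i hi
            · exact hρ s hi0
        _ = η / 3 * (d * ρ / (d * ρ + 1)) := by field_simp
        _ ≤ η / 3 * 1 := by
            gcongr
            rw [div_le_one (by positivity)]
            linarith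
        _ = η / 3 := mul_one _
    have hmv := Convex.norm_image_sub_le_of_norm_hasDerivWithin_le
      (f := fun r => X r - r • σ v) (f' := fun r => σ (F r) - σ v) (s := Icc s t) (x := s) (y := t)
      (C := L * η) (fun r hr => ((hX r (hsub hr)).mono hsub).sub (by
        simpa using ((hasDerivAt_id r).smul_const (σ v)).hasDerivWithinAt)) (fun r hr => by
        rw [← dist_eq_norm]
        refine (hσ.dist_le_mul _ _).trans ?_
        gcongr
        have h1 : dist (F r) (F s) < η / 3 := hδ r (hsub hr) s hi0 (by
          rw [Real.dist_eq, abs_of_nonneg (by linarith [hr.1])]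
          linarith [hr.2])
        have h2 := dist_triangle (F r) (F s) v
        rw [dist_eq_norm (F s) v] at h2
        linarith) (convex_Icc s t) (left_mem_Icc.mpr hst') (right_mem_Icc.mpr hst')
    rw [hst, Real.norm_of_nonneg (by positivity)] at hmv
    refine le_trans (le_of_eq ?_) hmv
    congr 1
    rw [← hst]
    module
  -- The discrete Grönwall argument.
  have herr : ∀ i ≤ n, ‖forward σ (K n) (b n) (X 0) i - X ((i : ℝ) / n)‖ ≤
      (i / n) * (L * η) * (1 + κ / n) ^ i := by
    intro i
    induction i with
    | zero => intro _; simp [forward]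
    | succ i ih =>
      intro hi
      have hi' : i < n := hi
      have ih' := ih hi'.le
      set e := ‖forward σ (K n) (b n) (X 0) i - X ((i : ℝ) / n)‖ with he
      set Y := forward σ (K n) (b n) (X 0) i with hY
      have hKi : ‖layer (K n) i‖ ≤ k + 1 := by
        have h1 := hK1 i hi'
        have h2 := hk _ (hmem i hi'.le)
        have h3 := norm_add_le (layer (K n) i - A ((i : ℝ) / n)) (A ((i : ℝ) / n))
        rw [sub_add_cancel] at h3
        linarith
      have hstep : ‖(1 / (n : ℝ)) • (σ (layer (K n) i *ᵥ Y + layer (b n) i) -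
          σ (layer (K n) i *ᵥ X ((i : ℝ) / n) + layer (b n) i))‖ ≤ κ / n * e := by
        rw [norm_smul, Real.norm_of_nonneg (by positivity), ← dist_eq_norm]
        calc _ ≤ 1 / (n : ℝ) * (L * (d * ((k + 1) * e))) := by
              gcongr
              refine (hσ.dist_le_mul _ _).trans ?_
              gcongr
              rw [dist_add_right, dist_eq_norm, ← Matrix.mulVec_sub]
              refine (norm_mulVec_le _ _).trans ?_
              gcongr
          _ = κ / n * e := by rw [hκ]; ring
      have hdecomp : forward σ (K n) (b n) (X 0) (i + 1) - X (((i + 1 : ℕ) : ℝ) / n) =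
          (Y - X ((i : ℝ) / n)) + (1 / (n : ℝ)) • (σ (layer (K n) i *ᵥ Y + layer (b n) i) -
          σ (layer (K n) i *ᵥ X ((i : ℝ) / n) + layer (b n) i)) -
          (X (((i + 1 : ℕ) : ℝ) / n) - X ((i : ℝ) / n) -
          (1 / (n : ℝ)) • σ (layer (K n) i *ᵥ X ((i : ℝ) / n) + layer (b n) i)) := by
        rw [forward, ← hY]
        module
      have hone : (1 : ℝ) ≤ (1 + κ / n) ^ (i + 1) :=
        one_le_pow₀ (by have : 0 ≤ κ / n := by positivity
                        linarith)
      calc _ ≤ e + κ / n * e + L * η * (1 / n) := by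
            rw [hdecomp]
            exact (norm_sub_le _ _).trans (add_le_add ((norm_add_le _ _).trans
              (add_le_add le_rfl hstep)) (hcons i hi'))
        _ = (1 + κ / n) * e + L * η * (1 / n) := by ring
        _ ≤ (1 + κ / n) * ((i / n) * (L * η) * (1 + κ / n) ^ i) +
            L * η * (1 / n) * (1 + κ / n) ^ (i + 1) := by
            refine add_le_add (mul_le_mul_of_nonneg_left ih' (by positivity)) ?_
            exact le_mul_of_one_le_right (by positivity) hone
        _ = _ := by push_cast; ring
  have hfin := herr n le_rfl
  rw [div_self hn'.ne'] at hfin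
  rw [dist_eq_norm]
  have hexp : (1 + κ / n) ^ n ≤ Real.exp κ := by
    calc (1 + κ / n) ^ n ≤ Real.exp (κ / n) ^ n :=
          pow_le_pow_left₀ (by positivity) (by linarith [Real.add_one_le_exp (κ / n)]) n
      _ = Real.exp κ := by rw [← Real.exp_nat_mul]; congr 1; field_simp
  calc _ ≤ 1 * (L * η) * (1 + κ / n) ^ n := hfin
    _ ≤ 1 * ((L + 1) * η) * Real.exp κ := by gcongr; linarith
    _ = ε / 2 := by rw [hη]; field_simp
    _ < ε := half_lt_self hε

end ODE

/-! ### The finite layer objective -/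

lemma continuous_layer {V : Type} [NormedAddCommGroup V] {n : ℕ} (i : ℕ) :
    Continuous fun a : Fin n → V => layer a i := by
  unfold layer
  split_ifs with h
  · exact continuous_apply _
  · exact continuous_const

lemma continuous_discreteReg {V : Type} [NormedAddCommGroup V] [NormedSpace ℝ V]
    [FiniteDimensional ℝ V] (N : VNorm V) (τ : ℝ) {n : ℕ} :
    Continuous fun a : Fin n → V => discreteReg N τ a := by
  unfold discreteReg
  refine (continuous_const.mul (continuous_finsetSum _ fun i _ => ?_)).add
    (continuous_const.mul ((N.continuous.comp (continuous_layer 0)).pow 2))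
  exact (N.continuous.comp ((continuous_layer i).sub (continuous_layer (i - 1)))).pow 2

lemma continuous_forward {d : ℕ} {σ : (Fin d → ℝ) → (Fin d → ℝ)} (hσ : Continuous σ) {n : ℕ}
    (x : Fin d → ℝ) (i : ℕ) :
    Continuous fun p : (Fin n → Matrix (Fin d) (Fin d) ℝ) × (Fin n → Fin d → ℝ) =>
      forward σ p.1 p.2 x i := by
  induction i with
  | zero => exact continuous_const
  | succ i ih =>
    exact ih.add ((hσ.comp ((continuous_mulVec.comp
      (((continuous_layer i).comp continuous_fst).prodMk ih)).add
      ((continuous_layer i).comp continuous_snd))).const_smul (1 / (n : ℝ)))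

namespace Model

variable {d m S : ℕ} (P : Model d m S)

/-- The terms of the objective bound the parameters. -/
lemma bounds_of_En_le (hα₁ : 0 < P.α₁) (hα₂ : 0 < P.α₂) (hα₃ : 0 < P.α₃) (hα₄ : 0 < P.α₄)
    (hτ₁ : 0 < P.τ₁) (hτ₂ : 0 < P.τ₂) {n : ℕ} {θ : ThetaN d m n} {C : ℝ} (h : P.En θ ≤ C) :
    discreteReg P.normK P.τ₁ θ.K ≤ C / P.α₁ ∧ discreteReg P.normB P.τ₂ θ.b ≤ C / P.α₂ ∧
      P.normW θ.W ≤ √(C / P.α₃) ∧ P.normC θ.c ≤ √(C / P.α₄) := by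
  have h0 : 0 ≤ ∑ s, P.normC (P.h (θ.W *ᵥ forward P.σ θ.K θ.b (P.x s) n + θ.c) - P.y s) ^ 2 :=
    Finset.sum_nonneg fun _ _ => sq_nonneg _
  have h1 := mul_nonneg hα₁.le (discreteReg_nonneg P.normK θ.K hτ₁.le)
  have h2 := mul_nonneg hα₂.le (discreteReg_nonneg P.normB θ.b hτ₂.le)
  have h3 := mul_nonneg hα₃.le (sq_nonneg (P.normW θ.W))
  have h4 := mul_nonneg hα₄.le (sq_nonneg (P.normC θ.c))
  unfold En at h
  refine ⟨?_, ?_, Real.le_sqrt_of_sq_le ?_, Real.le_sqrt_of_sq_le ?_⟩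
  · rw [le_div_iff₀ hα₁]; linarith
  · rw [le_div_iff₀ hα₂]; linarith
  · rw [le_div_iff₀ hα₃]; linarith
  · rw [le_div_iff₀ hα₄]; linarith

/-- The direct method: the objective is continuous and its sublevel sets are bounded. -/
theorem exists_minimiser (hα₁ : 0 < P.α₁) (hα₂ : 0 < P.α₂) (hα₃ : 0 < P.α₃) (hα₄ : 0 < P.α₄)
    (hτ₁ : 0 < P.τ₁) (hτ₂ : 0 < P.τ₂) (hh : Continuous P.h) (hσ : Continuous P.σ) (n : ℕ) :
    ∃ θ : ThetaN d m n, ∀ θ' : ThetaN d m n, P.En θ ≤ P.En θ' := by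
  let E := ((Fin n → Matrix (Fin d) (Fin d) ℝ) × (Fin n → Fin d → ℝ)) ×
    (Matrix (Fin m) (Fin d) ℝ × (Fin m → ℝ))
  let T : E → ThetaN d m n := fun p => ⟨p.1.1, p.1.2, p.2.1, p.2.2⟩
  have hcont : Continuous fun p : E => P.En (T p) := by
    have hW : Continuous fun p : E => p.2.1 := continuous_fst.comp continuous_snd
    have hc : Continuous fun p : E => p.2.2 := continuous_snd.comp continuous_snd
    refine ((((continuous_finsetSum _ fun s _ => ?_).add ?_).add ?_).add ?_).add ?_
    · refine (P.normC.continuous.comp (Continuous.sub (hh.comp ?_) continuous_const)).pow 2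
      exact (continuous_mulVec.comp (hW.prodMk
        ((continuous_forward hσ (P.x s) n).comp continuous_fst))).add hc
    · exact continuous_const.mul ((continuous_discreteReg P.normK P.τ₁).comp
        (continuous_fst.comp continuous_fst))
    · exact continuous_const.mul ((continuous_discreteReg P.normB P.τ₂).comp
        (continuous_snd.comp continuous_fst))
    · exact continuous_const.mul ((P.normW.continuous.comp hW).pow 2)
    · exact continuous_const.mul ((P.normC.continuous.comp hc).pow 2)
  obtain ⟨cK, hcK, hK⟩ := P.normK.exists_equiv
  obtain ⟨cB, hcB, hB⟩ := P.normB.exists_equiv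
  obtain ⟨cW, hcW, hW⟩ := P.normW.exists_equiv
  obtain ⟨cC, hcC, hC⟩ := P.normC.exists_equiv
  set C := P.En (T 0) with hCdef
  set RK := cK * (√(C / P.α₁) + √(C / P.α₁ / P.τ₁))
  set RB := cB * (√(C / P.α₂) + √(C / P.α₂ / P.τ₂))
  set RW := cW * √(C / P.α₃)
  set RC := cC * √(C / P.α₄)
  have hcompact : IsCompact {p : E | P.En (T p) ≤ C} := by
    refine (isCompact_closedBall (0 : E) (max (max RK RB) (max RW RC))).of_isClosed_subset
      (isClosed_le hcont continuous_const) (fun p hp => ?_)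
    obtain ⟨h1, h2, h3, h4⟩ := P.bounds_of_En_le hα₁ hα₂ hα₃ hα₄ hτ₁ hτ₂ hp
    rw [mem_closedBall_zero_iff, Prod.norm_def, Prod.norm_def, Prod.norm_def]
    refine max_le_max (max_le_max ?_ ?_) (max_le_max ?_ ?_)
    · rw [pi_norm_le_iff_of_nonneg (by positivity)]
      intro i
      have := layer_le P.normK p.1.1 hτ₁ h1 i
      simp only [layer, dif_pos i.2, Fin.eta] at this
      exact (hK _).2.trans (mul_le_mul_of_nonneg_left this hcK.le)
    · rw [pi_norm_le_iff_of_nonneg (by positivity)]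
      intro i
      have := layer_le P.normB p.1.2 hτ₂ h2 i
      simp only [layer, dif_pos i.2, Fin.eta] at this
      exact (hB _).2.trans (mul_le_mul_of_nonneg_left this hcB.le)
    · exact (hW _).2.trans (mul_le_mul_of_nonneg_left h3 hcW.le)
    · exact (hC _).2.trans (mul_le_mul_of_nonneg_left h4 hcC.le)
  obtain ⟨p, hp, hmin⟩ := hcompact.exists_isMinOn ⟨0, le_refl C⟩ hcont.continuousOn
  refine ⟨T p, fun θ' => ?_⟩
  by_cases h : P.En θ' ≤ C
  · exact hmin (a := ((θ'.K, θ'.b), (θ'.W, θ'.c))) h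
  · exact (show P.En (T p) ≤ C from hp).trans (not_le.mp h).le

/-! ### Compactness and Gamma-convergence of the objectives -/

lemma dist_terms_nonneg {n : ℕ} (θn : ThetaN d m n) (θ : Theta d m) :
    0 ≤ stepDist P.normK θn.K θ.K ∧ 0 ≤ stepDist P.normB θn.b θ.b ∧
      0 ≤ P.normW (θn.W - θ.W) ∧ 0 ≤ P.normC (θn.c - θ.c) :=
  ⟨Real.sqrt_nonneg _, Real.sqrt_nonneg _, P.normW.nonneg _, P.normC.nonneg _⟩

/-- Sequences of bounded objective are relatively compact. -/
theorem relCompactSeq (hα₁ : 0 < P.α₁) (hα₂ : 0 < P.α₂) (hα₃ : 0 < P.α₃) (hα₄ : 0 < P.α₄)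
    (hτ₁ : 0 < P.τ₁) (hτ₂ : 0 < P.τ₂) (θ : ∀ n : ℕ, ThetaN d m n) {C : ℝ}
    (hC : ∀ n : ℕ, 1 ≤ n → P.En (θ n) ≤ C) : RelCompactSeq (fun _ => P.dist) θ := by
  intro φ hφ
  have hb := fun n hn => P.bounds_of_En_le hα₁ hα₂ hα₃ hα₄ hτ₁ hτ₂ (hC n hn)
  obtain ⟨cW, hcW, hW⟩ := P.normW.exists_equiv
  obtain ⟨cC, hcC, hC'⟩ := P.normC.exists_equiv
  obtain ⟨ψ₁, hψ₁, K, hK, hKlim⟩ := exists_subseq_tendsto_stepDist P.normK (fun n => (θ n).K) hτ₁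
    (fun n hn => (hb n hn).1) hφ
  obtain ⟨ψ₂, hψ₂, b, hbH, hblim⟩ := exists_subseq_tendsto_stepDist P.normB (fun n => (θ n).b) hτ₂
    (fun n hn => (hb n hn).2.1) (hφ.comp hψ₁)
  set χ : ℕ → ℕ := fun k => φ (ψ₁ (ψ₂ k)) with hχ
  have hχm : StrictMono χ := (hφ.comp hψ₁).comp hψ₂
  have hbdd : ∀ᶠ k in atTop, ((θ (χ k)).W, (θ (χ k)).c) ∈
      Metric.closedBall (0 : Matrix (Fin m) (Fin d) ℝ) (cW * √(C / P.α₃)) ×ˢ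
      Metric.closedBall (0 : Fin m → ℝ) (cC * √(C / P.α₄)) := by
    filter_upwards [hχm.tendsto_atTop.eventually (eventually_ge_atTop 1)] with k hk
    refine ⟨?_, ?_⟩
    · rw [mem_closedBall_zero_iff]
      exact (hW _).2.trans (mul_le_mul_of_nonneg_left (hb _ hk).2.2.1 hcW.le)
    · rw [mem_closedBall_zero_iff]
      exact (hC' _).2.trans (mul_le_mul_of_nonneg_left (hb _ hk).2.2.2 hcC.le)
  obtain ⟨⟨W, c⟩, -, ψ₃, hψ₃, hlim⟩ := ((isCompact_closedBall _ _).prod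
    (isCompact_closedBall _ _)).tendsto_subseq' hbdd.frequently
  refine ⟨fun k => ψ₁ (ψ₂ (ψ₃ k)), (hψ₁.comp hψ₂).comp hψ₃, ⟨K, b, W, c, hK, hbH⟩, ?_⟩
  have h1 := hKlim.comp (hψ₂.comp hψ₃).tendsto_atTop
  have h2 := hblim.comp hψ₃.tendsto_atTop
  have h3 := P.normW.tendsto_zero_iff.mpr (tendsto_sub_nhds_zero_iff.mpr hlim.fst_nhds)
  have h4 := P.normC.tendsto_zero_iff.mpr (tendsto_sub_nhds_zero_iff.mpr hlim.snd_nhds)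
  have h5 := ((h1.add h2).add h3).add h4
  simp only [add_zero] at h5
  exact h5

/-- Convergence of all terms of the objective except for the regularisers of `K` and `b`. -/
lemma tendsto_data (hh : Continuous P.h) {L : NNReal} (hσ : LipschitzWith L P.σ)
    (hσ0 : P.σ 0 = 0) (θ : Theta d m) {l : Filter ℕ} (hl : l ≤ atTop) (u : ∀ n, ThetaN d m n)
    (hK : ∀ ε > 0, ∀ᶠ n in l, ∀ i < n,
      P.normK (layer (u n).K i - contRep θ.K ((i : ℝ) / n)) ≤ ε)
    (hb : ∀ ε > 0, ∀ᶠ n in l, ∀ i < n,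
      P.normB (layer (u n).b i - contRep θ.b ((i : ℝ) / n)) ≤ ε)
    (hW : Tendsto (fun n => P.normW ((u n).W - θ.W)) l (𝓝 0))
    (hc : Tendsto (fun n => P.normC ((u n).c - θ.c)) l (𝓝 0)) :
    Tendsto (fun n => (∑ s, P.normC (P.h ((u n).W *ᵥ forward P.σ (u n).K (u n).b (P.x s) n
        + (u n).c) - P.y s) ^ 2) + (P.α₃ * P.normW (u n).W ^ 2 + P.α₄ * P.normC (u n).c ^ 2)) l
      (𝓝 ((∑ s, P.normC (P.h (θ.W *ᵥ odeSolution P.σ θ.K θ.b (P.x s) 1 + θ.c) - P.y s) ^ 2)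
        + (P.α₃ * P.normW θ.W ^ 2 + P.α₄ * P.normC θ.c ^ 2))) := by
  obtain ⟨cK, hcK, hNK⟩ := P.normK.exists_equiv
  obtain ⟨cB, hcB, hNB⟩ := P.normB.exists_equiv
  have hW' : Tendsto (fun n => (u n).W) l (𝓝 θ.W) :=
    tendsto_sub_nhds_zero_iff.mp (P.normW.tendsto_zero_iff.mp hW)
  have hc' : Tendsto (fun n => (u n).c) l (𝓝 θ.c) :=
    tendsto_sub_nhds_zero_iff.mp (P.normC.tendsto_zero_iff.mp hc)
  refine Tendsto.add (tendsto_finsetSum _ fun s _ => ?_) (Tendsto.add ?_ ?_)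
  · have hode := odeSolution_spec hσ hσ0 θ.memH1_K θ.memH1_b (P.x s)
    have hfw := tendsto_forward hσ θ.memH1_K.contRep_spec.1 θ.memH1_b.contRep_spec.1 hode.2 hl
      (K := fun n => (u n).K) (b := fun n => (u n).b)
      (fun ε hε => by
        filter_upwards [hK (ε / cK) (by positivity)] with n hn i hi
        refine (hNK _).2.trans ?_
        have := hn i hi
        rw [le_div_iff₀ hcK] at this
        linarith)
      (fun ε hε => by
        filter_upwards [hb (ε / cB) (by positivity)] with n hn i hi
        refine (hNB _).2.trans ?_
        have := hn i hi
        rw [le_div_iff₀ hcB] at this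
        linarith)
    rw [hode.1] at hfw
    have hWf : Tendsto (fun n => (u n).W *ᵥ forward P.σ (u n).K (u n).b (P.x s) n) l
        (𝓝 (θ.W *ᵥ odeSolution P.σ θ.K θ.b (P.x s) 1)) :=
      (continuous_mulVec.tendsto (θ.W, odeSolution P.σ θ.K θ.b (P.x s) 1)).comp
        (hW'.prodMk_nhds hfw)
    exact ((P.normC.continuous.tendsto _).comp
      (((hh.tendsto _).comp (hWf.add hc')).sub_const (P.y s))).pow 2
  · exact (((P.normW.continuous.tendsto _).comp hW').pow 2).const_mul _
  · exact (((P.normC.continuous.tendsto _).comp hc').pow 2).const_mul _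

/-- Along any filter on which the objective stays bounded, the limiting objective is
asymptotically a lower bound. -/
lemma eventually_Einf_le (hα₁ : 0 < P.α₁) (hα₂ : 0 < P.α₂) (hα₃ : 0 < P.α₃) (hα₄ : 0 < P.α₄)
    (hτ₁ : 0 < P.τ₁) (hτ₂ : 0 < P.τ₂) (hh : Continuous P.h) {L : NNReal}
    (hσ : LipschitzWith L P.σ) (hσ0 : P.σ 0 = 0) (θ : Theta d m) {l : Filter ℕ} (hl : l ≤ atTop)
    (u : ∀ n, ThetaN d m n) (hd : Tendsto (fun n => P.dist (u n) θ) l (𝓝 0)) {C : ℝ}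
    (hC : ∀ᶠ n in l, P.En (u n) ≤ C) {ε : ℝ} (hε : 0 < ε) :
    ∀ᶠ n in l, P.Einf θ ≤ P.En (u n) + ε := by
  have hsq : ∀ f : ℕ → ℝ, (∀ n, 0 ≤ f n) → (∀ n, f n ≤ P.dist (u n) θ) → Tendsto f l (𝓝 0) :=
    fun f h0 h1 => squeeze_zero h0 h1 hd
  have hnn := fun n => P.dist_terms_nonneg (u n) θ
  have hdK : Tendsto (fun n => stepDist P.normK (u n).K θ.K) l (𝓝 0) :=
    hsq _ (fun n => (hnn n).1) (fun n => by
      have := hnn n; unfold Model.dist; linarith [this.2.1, this.2.2.1, this.2.2.2])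
  have hdb : Tendsto (fun n => stepDist P.normB (u n).b θ.b) l (𝓝 0) :=
    hsq _ (fun n => (hnn n).2.1) (fun n => by
      have := hnn n; unfold Model.dist; linarith [this.1, this.2.2.1, this.2.2.2])
  have hdW : Tendsto (fun n => P.normW ((u n).W - θ.W)) l (𝓝 0) :=
    hsq _ (fun n => (hnn n).2.2.1) (fun n => by
      have := hnn n; unfold Model.dist; linarith [this.1, this.2.1, this.2.2.2])
  have hdc : Tendsto (fun n => P.normC ((u n).c - θ.c)) l (𝓝 0) :=
    hsq _ (fun n => (hnn n).2.2.2) (fun n => by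
      have := hnn n; unfold Model.dist; linarith [this.1, this.2.1, this.2.2.1])
  have hbd := hC.mono fun n hn => P.bounds_of_En_le hα₁ hα₂ hα₃ hα₄ hτ₁ hτ₂ hn
  have hK := fun (ε : ℝ) (hε : ε > 0) => eventually_layer_sub_le P.normK hl (fun n => (u n).K)
    hτ₁.le (hbd.mono fun n hn => hn.1) θ.memH1_K.contRep_spec.1
    (hdK.congr fun n => stepDist_congr _ _ θ.memH1_K.contRep_spec.2) hε
  have hb := fun (ε : ℝ) (hε : ε > 0) => eventually_layer_sub_le P.normB hl (fun n => (u n).b)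
    hτ₂.le (hbd.mono fun n hn => hn.2.1) θ.memH1_b.contRep_spec.1
    (hdb.congr fun n => stepDist_congr _ _ θ.memH1_b.contRep_spec.2) hε
  have hdata := P.tendsto_data hh hσ hσ0 θ hl u hK hb hdW hdc
  filter_upwards [eventually_continuumReg_le P.normK hl (fun n => (u n).K) (τ := P.τ₁) θ.memH1_K hK
      (show 0 < ε / (3 * P.α₁) by positivity),
    eventually_continuumReg_le P.normB hl (fun n => (u n).b) (τ := P.τ₂) θ.memH1_b hb
      (show 0 < ε / (3 * P.α₂) by positivity),
    hdata.eventually_const_lt (sub_lt_self _ (show 0 < ε / 3 by positivity))] with n h1 h2 h3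
  have h1' := mul_le_mul_of_nonneg_left h1 hα₁.le
  have h2' := mul_le_mul_of_nonneg_left h2 hα₂.le
  have e1 : P.α₁ * (ε / (3 * P.α₁)) = ε / 3 := by field_simp
  have e2 : P.α₂ * (ε / (3 * P.α₂)) = ε / 3 := by field_simp
  rw [mul_add, e1] at h1'
  rw [mul_add, e2] at h2'
  unfold Einf En
  linarith

theorem Einf_le_liminf (hα₁ : 0 < P.α₁) (hα₂ : 0 < P.α₂) (hα₃ : 0 < P.α₃) (hα₄ : 0 < P.α₄)
    (hτ₁ : 0 < P.τ₁) (hτ₂ : 0 < P.τ₂) (hh : Continuous P.h) {L : NNReal}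
    (hσ : LipschitzWith L P.σ) (hσ0 : P.σ 0 = 0) (θ : Theta d m)
    (u : ∀ n, ThetaN d m n) (hd : Tendsto (fun n => P.dist (u n) θ) atTop (𝓝 0)) :
    (P.Einf θ : EReal) ≤ liminf (fun n => (P.En (u n) : EReal)) atTop := by
  by_contra hcon
  rw [not_le] at hcon
  obtain ⟨C, hC1, hC2⟩ := EReal.lt_iff_exists_real_btwn.mp hcon
  have hfreq := frequently_lt_of_liminf_lt (by isBoundedDefault) hC1
  -- Restrict the sequence to the indices at which the objective is below `C`.
  set l := atTop ⊓ 𝓟 {n | (P.En (u n) : EReal) < C} with hl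
  have hne : l.NeBot := frequently_mem_iff_neBot.mp hfreq
  have hEC : ∀ᶠ n in l, P.En (u n) ≤ C := by
    filter_upwards [mem_inf_of_right (mem_principal_self _)] with n hn
    exact (EReal.coe_lt_coe_iff.mp hn).le
  have hle : P.Einf θ ≤ C := by
    refine le_of_forall_pos_le_add fun ε hε => ?_
    obtain ⟨n, h1, h2⟩ := ((P.eventually_Einf_le hα₁ hα₂ hα₃ hα₄ hτ₁ hτ₂ hh hσ hσ0 θ inf_le_left u
      (hd.mono_left inf_le_left) hEC hε).and hEC).exists
    linarith
  exact absurd hC2 (not_lt.mpr (EReal.coe_le_coe_iff.mpr hle))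

theorem exists_recovery (hα₁ : 0 < P.α₁) (hα₂ : 0 < P.α₂) (hh : Continuous P.h) {L : NNReal}
    (hσ : LipschitzWith L P.σ) (hσ0 : P.σ 0 = 0) (θ : Theta d m) :
    ∃ u : ∀ n, ThetaN d m n, Tendsto (fun n => P.dist (u n) θ) atTop (𝓝 0) ∧
      limsup (fun n => (P.En (u n) : EReal)) atTop ≤ (P.Einf θ : EReal) := by
  let u : ∀ n, ThetaN d m n := fun n => ⟨sample θ.K n, sample θ.b n, θ.W, θ.c⟩
  have hW : Tendsto (fun n => P.normW ((u n).W - θ.W)) atTop (𝓝 0) := by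
    simp only [u, sub_self, P.normW.map_zero]
    exact tendsto_const_nhds
  have hc : Tendsto (fun n => P.normC ((u n).c - θ.c)) atTop (𝓝 0) := by
    simp only [u, sub_self, P.normC.map_zero]
    exact tendsto_const_nhds
  refine ⟨u, ?_, ?_⟩
  · have h := (((tendsto_stepDist_sample P.normK θ.memH1_K).add
      (tendsto_stepDist_sample P.normB θ.memH1_b)).add hW).add hc
    simp only [add_zero] at h
    exact h
  · have hdata := P.tendsto_data hh hσ hσ0 θ le_rfl u
      (fun ε hε => Eventually.of_forall fun n i hi => by
        rw [layer_sample θ.K hi, sub_self, P.normK.map_zero]; exact hε.le)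
      (fun ε hε => Eventually.of_forall fun n i hi => by
        rw [layer_sample θ.b hi, sub_self, P.normB.map_zero]; exact hε.le) hW hc
    refine EReal.le_of_forall_lt_iff_le.mp fun z hz => ?_
    have hz' : 0 < z - P.Einf θ := sub_pos.mpr (EReal.coe_lt_coe_iff.mp hz)
    refine limsup_le_of_le (by isBoundedDefault) ?_
    filter_upwards [eventually_gt_atTop 0, hdata.eventually_lt_const
      (lt_add_of_pos_right _ hz')] with n hn h3
    refine EReal.coe_le_coe_iff.mpr ?_
    have h1 := mul_le_mul_of_nonneg_left
      (discreteReg_sample_le P.normK (τ := P.τ₁) θ.memH1_K hn) hα₁.le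
    have h2 := mul_le_mul_of_nonneg_left
      (discreteReg_sample_le P.normB (τ := P.τ₂) θ.memH1_b hn) hα₂.le
    unfold Einf En at *
    simp only [u] at *
    linarith

end Model

end DeepLayer

theorem mainTheorem2 {d m S : ℕ} (hS : 1 ≤ S) (P : DeepLayer.Model d m S)
    (hα₁ : 0 < P.α₁) (hα₂ : 0 < P.α₂) (hα₃ : 0 < P.α₃) (hα₄ : 0 < P.α₄)
    (hτ₁ : 0 < P.τ₁) (hτ₂ : 0 < P.τ₂)
    (hh : Continuous P.h)
    (hσ : ∃ L : NNReal, LipschitzWith L P.σ)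
    (hσ0 : P.σ 0 = 0) :
    -- existence of minimisers
    (∀ n : ℕ, 1 ≤ n → ∃ θ : DeepLayer.ThetaN d m n, ∀ θ' : DeepLayer.ThetaN d m n,
      P.En θ ≤ P.En θ') ∧
    -- compactness
    (∀ θ : ∀ n : ℕ, DeepLayer.ThetaN d m n,
      (∃ C : ℝ, ∀ n : ℕ, 1 ≤ n → P.En (θ n) ≤ C) →
        DeepLayer.RelCompactSeq (fun _ => P.dist) θ) ∧
    -- Gamma-convergence
    DeepLayer.GammaConverges (A := DeepLayer.ThetaN d m) (fun _ => P.dist) (fun _ => P.En)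
      P.Einf := by
  obtain ⟨L, hL⟩ := hσ
  refine ⟨fun n _ => P.exists_minimiser hα₁ hα₂ hα₃ hα₄ hτ₁ hτ₂ hh hL.continuous n,
    fun θ ⟨C, hC⟩ => P.relCompactSeq hα₁ hα₂ hα₃ hα₄ hτ₁ hτ₂ θ hC, fun θ => ⟨fun u hu => ?_, ?_⟩⟩
  · exact P.Einf_le_liminf hα₁ hα₂ hα₃ hα₄ hτ₁ hτ₂ hh hL hσ0 θ u hu
  · exact P.exists_recovery hα₁ hα₂ hh hL hσ0 θ
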